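/- Let $w_0\in C^\infty(\mathbb{R}^2)$ be a radial function with $w_0(x)=\ln|x|$ for $|x|\ge 1$. Let $K:\mathbb{R}^2\to\mathbb{R}$ be a measurable, locally bounded function with $K\le 0$, let $\alpha>0$ and $t\in\mathbb{R}$. Equations are understood in the sense of distributions. Assume that there exists a bounded solution $v$ of $$-\Delta v = K e^{2\alpha w_0+2t}+\alpha\Delta w_0\quad\text{in }\mathbb{R}^2 .$$ Then the equation $$\Delta u+K(x)e^{2u}=0\quad\text{in }\mathbb{R}^2$$ has exactly one continuous solution $u$ satisfying $u(x)=\alpha\ln|x|+O(1)$ as $|x|\to\infty$. Moreover, for this solution $Ke^{2u}\in L^1(\mathbb{R}^2)$, and its total curvature is $$\int_{\mathbb{R}^2}K e^{2u}\,dx=-2\alpha\pi .$$ -/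

import Mathlib

open MeasureTheory Asymptotics Filter
open scoped ContDiff

/-- The Euclidean plane, with its Euclidean norm and Lebesgue measure. -/
abbrev Plane : Type := EuclideanSpace ℝ (Fin 2)

/-- `-Δ u = f` in the plane, in the sense of distributions: `u` and `f` are locally integrable and
`-∫ u Δφ = ∫ f φ` for every smooth compactly supported test function `φ`. -/
def SolvesPoisson (u f : Plane → ℝ) : Prop :=
  LocallyIntegrable u volume ∧ LocallyIntegrable f volume ∧
    ∀ φ : Plane → ℝ, ContDiff ℝ ∞ φ → HasCompactSupport φ →
      -∫ x, u x * (Laplacian.laplacian φ : Plane → ℝ) x = ∫ x, f x * φ x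

/-- `K` is bounded on every ball centred at the origin. -/
def IsLocallyBounded (K : Plane → ℝ) : Prop :=
  ∀ R : ℝ, ∃ C : ℝ, ∀ x : Plane, ‖x‖ ≤ R → |K x| ≤ C

/-- A continuous solution `u` of `Δ u + K e^{2u} = 0` in the plane (in the sense of distributions)
with `u(x) = α ln |x| + O(1)` as `|x| → ∞`. -/
def IsLogGrowthSolution (K : Plane → ℝ) (α : ℝ) (u : Plane → ℝ) : Prop :=
  Continuous u ∧
    SolvesPoisson u (fun x => K x * Real.exp (2 * u x)) ∧
    (fun x => u x - α * Real.log ‖x‖) =O[cocompact Plane] (fun _ => (1 : ℝ))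

/-!
Total curvature: testing the equation against a cutoff that depends on `log ‖x‖` only, and lives on
the scale `L` in that variable, has a Laplacian of total mass `O(1 / L)` away from the origin. So
bounded perturbations of `α log ‖x‖` are invisible as `L → ∞`, while `α log ‖x‖` itself
contributes `2 π α`.

Uniqueness: the difference `w` of two solutions is bounded and `w Δ w ≥ 0` because `K ≤ 0`. The same
cutoffs (parabolicity of the plane) give `w Δ w = 0`, so `K w = 0` almost everywhere, `w` is bounded
and harmonic, hence constant, and a nonzero constant would force `K = 0`, contradicting the total
curvature.

Existence: the unknown is `u = α w₀ + v + y`, where `y` solves a semilinear equation `Δ y = H x y`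
with `H` nondecreasing in `y` and constant barriers `± c`. Adding `ε y`, truncating in space and
inverting `L + ε - Δ` by its explicit kernel turns this into a contraction; the solutions are
bounded by `c` and equicontinuous, and a locally uniform limit as `ε → 0` solves the equation. The
kernel is a Laplace transform of heat kernels. Equicontinuity comes from mollifying with
`Δ (w₀ (2ᵏ ·)) / 2 π`: consecutive kernels differ by the Laplacian of a function of `L¹` norm
`O(4⁻ᵏ)`, so the mollified solutions are close to the solutions, uniformly in `ε`.
-/

open scoped Topology Laplacian Convolution

section DirectionalDerivative

variable {F : Type*} [NormedAddCommGroup F] [NormedSpace ℝ F]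

theorem contDiff_fderiv_apply_const {f : F → ℝ} (hf : ContDiff ℝ ∞ f) (v : F) :
    ContDiff ℝ ∞ (fun y => fderiv ℝ f y v) :=
  (hf.fderiv_right (m := ∞) (by norm_cast)).clm_apply contDiff_const

theorem fderiv_comp_const_add_smul {f : F → ℝ} {a : F} {c : ℝ} {x : F}
    (hf : DifferentiableAt ℝ f (a + c • x)) (v : F) :
    fderiv ℝ (fun y => f (a + c • y)) x v = c * fderiv ℝ f (a + c • x) v := by
  have haff : HasFDerivAt (fun y : F => a + c • y) (c • ContinuousLinearMap.id ℝ F) x :=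
    ((hasFDerivAt_id x).const_smul c).const_add a
  have hcomp : HasFDerivAt (fun y => f (a + c • y)) _ x := hf.hasFDerivAt.comp x haff
  simp [hcomp.fderiv]

end DirectionalDerivative

section LaplacianCalculus

variable {E : Type*} [NormedAddCommGroup E] [InnerProductSpace ℝ E] [FiniteDimensional ℝ E]

theorem laplacian_eq_sum_fderiv {ι : Type*} [Fintype ι] (b : OrthonormalBasis ι ℝ E) {f : E → ℝ}
    {x : E} (hf : ContDiffAt ℝ 2 f x) :
    Δ f x = ∑ i, fderiv ℝ (fun y => fderiv ℝ f y (b i)) x (b i) := by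
  rw [InnerProductSpace.laplacian_eq_iteratedFDeriv_orthonormalBasis f b]
  refine Finset.sum_congr rfl fun i _ => ?_
  have hd : DifferentiableAt ℝ (fderiv ℝ f) x :=
    (hf.fderiv_right (m := 1) (by norm_num)).differentiableAt one_ne_zero
  rw [iteratedFDeriv_two_apply, fderiv_clm_apply hd (differentiableAt_const _)]
  simp

theorem laplacian_eq_sum_fderiv_of_contDiff {ι : Type*} [Fintype ι] (b : OrthonormalBasis ι ℝ E)
    {f : E → ℝ} (hf : ContDiff ℝ ∞ f) :
    Δ f = fun x => ∑ i, fderiv ℝ (fun y => fderiv ℝ f y (b i)) x (b i) :=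
  funext fun _ => laplacian_eq_sum_fderiv b (hf.of_le (by norm_cast)).contDiffAt

theorem contDiff_laplacian {f : E → ℝ} (hf : ContDiff ℝ ∞ f) : ContDiff ℝ ∞ (Δ f) := by
  rw [laplacian_eq_sum_fderiv_of_contDiff (stdOrthonormalBasis ℝ E) hf]
  exact ContDiff.sum fun i _ => contDiff_fderiv_apply_const (contDiff_fderiv_apply_const hf _) _

theorem laplacian_eq_zero_of_eventuallyEq_const {f : E → ℝ} {x : E} {c : ℝ}
    (h : f =ᶠ[𝓝 x] fun _ => c) : Δ f x = 0 := by
  rw [(InnerProductSpace.laplacian_congr_nhds h).eq_of_nhds, InnerProductSpace.laplacian_const]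
  rfl

theorem hasCompactSupport_laplacian {f : E → ℝ} (hf : HasCompactSupport f) :
    HasCompactSupport (Δ f) := by
  refine hf.of_isClosed_subset (isClosed_tsupport _)
    (closure_minimal (fun x hx => ?_) (isClosed_tsupport f))
  by_contra h
  exact hx (laplacian_eq_zero_of_eventuallyEq_const (notMem_tsupport_iff_eventuallyEq.1 h))

theorem sum_sq_apply_orthonormalBasis {ι : Type*} [Fintype ι] (b : OrthonormalBasis ι ℝ E)
    (L : E →L[ℝ] ℝ) : ∑ i, L (b i) ^ 2 = ‖L‖ ^ 2 := by
  have := FiniteDimensional.complete ℝ E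
  have hL (v : E) : L v = inner ℝ v ((InnerProductSpace.toDual ℝ E).symm L) := by
    rw [real_inner_comm, InnerProductSpace.toDual_symm_apply]
  rw [← (InnerProductSpace.toDual ℝ E).symm.norm_map L, ← b.sum_sq_norm_inner_right]
  simp only [hL, Real.norm_eq_abs, sq_abs]

theorem laplacian_comp {f : E → ℝ} {β : ℝ → ℝ} {x : E} (hf : ContDiffAt ℝ 2 f x)
    (hβ : ContDiffAt ℝ 2 β (f x)) :
    Δ (fun y => β (f y)) x =
      deriv (deriv β) (f x) * ‖fderiv ℝ f x‖ ^ 2 + deriv β (f x) * Δ f x := by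
  have hfd : DifferentiableAt ℝ f x := hf.differentiableAt two_ne_zero
  have hβ' : DifferentiableAt ℝ (deriv β) (f x) := by
    have : ContDiffAt ℝ 1 (fderiv ℝ β) (f x) := hβ.fderiv_right (by norm_num)
    exact (this.differentiableAt one_ne_zero).clm_apply (differentiableAt_const (1 : ℝ))
  have chain : fderiv ℝ (fun y => β (f y)) =ᶠ[𝓝 x] fun y => deriv β (f y) • fderiv ℝ f y := by
    filter_upwards [hf.eventually (by simp), hf.continuousAt.eventually (hβ.eventually (by simp))]
      with y hfy hβy
    exact ((hβy.differentiableAt two_ne_zero).hasDerivAt.comp_hasFDerivAt y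
      (hfy.differentiableAt two_ne_zero).hasFDerivAt).fderiv
  let b := stdOrthonormalBasis ℝ E
  rw [laplacian_eq_sum_fderiv b hf, laplacian_eq_sum_fderiv b (f := fun y => β (f y))
    (hβ.comp x hf), ← sum_sq_apply_orthonormalBasis b, Finset.mul_sum, Finset.mul_sum,
    ← Finset.sum_add_distrib]
  refine Finset.sum_congr rfl fun i _ => ?_
  have hfi : DifferentiableAt ℝ (fun y => fderiv ℝ f y (b i)) x :=
    ((hf.fderiv_right (m := 1) (by norm_num)).differentiableAt one_ne_zero).clm_apply
      (differentiableAt_const _)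
  have product : HasFDerivAt (fun y => deriv β (f y) * fderiv ℝ f y (b i)) _ x :=
    (hβ'.hasDerivAt.comp_hasFDerivAt x hfd.hasFDerivAt).mul hfi.hasFDerivAt
  have chain_apply : (fun y => fderiv ℝ (fun y => β (f y)) y (b i)) =ᶠ[𝓝 x]
      fun y => deriv β (f y) * fderiv ℝ f y (b i) :=
    chain.fun_comp fun L : E →L[ℝ] ℝ => L (b i)
  rw [chain_apply.fderiv_eq, product.fderiv]
  simp only [add_apply, smul_apply, smul_eq_mul, Function.comp_apply]
  ring

theorem laplacian_sq {f : E → ℝ} {x : E} (hf : ContDiffAt ℝ 2 f x) :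
    Δ (fun y => f y ^ 2) x = 2 * ‖fderiv ℝ f x‖ ^ 2 + 2 * f x * Δ f x := by
  have hd : deriv (fun s : ℝ => s ^ 2) = fun s => 2 * s := by ext s; simp
  rw [laplacian_comp (β := fun s => s ^ 2) hf (by fun_prop), hd,
    deriv_const_mul _ differentiableAt_fun_id, deriv_id'', mul_one]

theorem laplacian_norm_sq (x : E) : Δ (fun y : E => ‖y‖ ^ 2) x = 2 * Module.finrank ℝ E := by
  let b := stdOrthonormalBasis ℝ E
  have hd (y v : E) : fderiv ℝ (fun y : E => ‖y‖ ^ 2) y v = 2 * inner ℝ v y := by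
    rw [(hasStrictFDerivAt_norm_sq y).hasFDerivAt.fderiv]
    simp [real_inner_comm]
  have hdd (v : E) : HasFDerivAt (fun y : E => 2 * inner ℝ v y) ((2 : ℝ) • innerSL ℝ v) x :=
    (innerSL ℝ v).hasFDerivAt.const_mul 2
  rw [laplacian_eq_sum_fderiv b (contDiff_norm_sq ℝ).contDiffAt]
  simp only [hd, (hdd _).fderiv]
  simp [mul_comm]

theorem laplacian_comp_norm_sq {β : ℝ → ℝ} {x : E} (hβ : ContDiffAt ℝ 2 β (‖x‖ ^ 2)) :
    Δ (fun y : E => β (‖y‖ ^ 2)) x =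
      4 * ‖x‖ ^ 2 * deriv (deriv β) (‖x‖ ^ 2) + 2 * Module.finrank ℝ E * deriv β (‖x‖ ^ 2) := by
  rw [laplacian_comp (f := fun y => ‖y‖ ^ 2) (contDiff_norm_sq ℝ).contDiffAt hβ, laplacian_norm_sq,
    (hasStrictFDerivAt_norm_sq x).hasFDerivAt.fderiv, ← Nat.cast_smul_eq_nsmul ℝ, norm_smul,
    innerSL_apply_norm, Nat.cast_ofNat, Real.norm_ofNat]
  ring

theorem laplacian_comp_const_add_smul {f : E → ℝ} (hf : ContDiff ℝ ∞ f) (a : E) (c : ℝ) (x : E) :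
    Δ (fun y => f (a + c • y)) x = c ^ 2 * Δ f (a + c • x) := by
  let b := stdOrthonormalBasis ℝ E
  have hg : ContDiff ℝ ∞ (fun y => f (a + c • y)) := by fun_prop
  have hfi (v : E) : Differentiable ℝ (fun y => fderiv ℝ f y v) :=
    (contDiff_fderiv_apply_const hf v).differentiable (by simp)
  rw [laplacian_eq_sum_fderiv b (hg.of_le (by norm_cast)).contDiffAt,
    laplacian_eq_sum_fderiv b (hf.of_le (by norm_cast)).contDiffAt, Finset.mul_sum]
  refine Finset.sum_congr rfl fun i _ => ?_
  simp only [fderiv_comp_const_add_smul (hf.differentiable (by simp) _)]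
  have hfi_aff : DifferentiableAt ℝ (fun y => fderiv ℝ f (a + c • y) (b i)) x :=
    ((hfi (b i)).comp (by fun_prop : Differentiable ℝ fun y : E => a + c • y)) x
  rw [fderiv_const_mul hfi_aff, smul_apply, fderiv_comp_const_add_smul (hfi (b i) _) (b i),
    smul_eq_mul]
  ring

variable [MeasurableSpace E] [BorelSpace E]

theorem integral_mul_fderiv_eq_neg {f φ : E → ℝ} (hf : ContDiff ℝ ∞ f)
    (hφ : ContDiff ℝ ∞ φ) (hc : HasCompactSupport φ) (v : E) :
    ∫ x, f x * fderiv ℝ φ x v = -∫ x, fderiv ℝ f x v * φ x :=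
  integral_mul_fderiv_eq_neg_fderiv_mul_of_integrable
    (((contDiff_fderiv_apply_const hf v).continuous.mul
      hφ.continuous).integrable_of_hasCompactSupport hc.mul_left)
    ((hf.continuous.mul (contDiff_fderiv_apply_const hφ v).continuous
      ).integrable_of_hasCompactSupport (hc.fderiv_apply (𝕜 := ℝ) v).mul_left)
    ((hf.continuous.mul hφ.continuous).integrable_of_hasCompactSupport hc.mul_left)
    (fun x _ => hf.differentiable (by simp) x) (fun x _ => hφ.differentiable (by simp) x)

theorem integral_mul_laplacian {f φ : E → ℝ} (hf : ContDiff ℝ ∞ f)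
    (hφ : ContDiff ℝ ∞ φ) (hc : HasCompactSupport φ) :
    ∫ x, f x * Δ φ x = ∫ x, Δ f x * φ x := by
  let b := stdOrthonormalBasis ℝ E
  have hf' (i) := contDiff_fderiv_apply_const hf (b i)
  have hφ' (i) := contDiff_fderiv_apply_const hφ (b i)
  have hc' (i) : HasCompactSupport (fun x => fderiv ℝ φ x (b i)) := hc.fderiv_apply (𝕜 := ℝ) _
  rw [laplacian_eq_sum_fderiv_of_contDiff b hf, laplacian_eq_sum_fderiv_of_contDiff b hφ]
  simp only [Finset.mul_sum, Finset.sum_mul]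
  rw [integral_finsetSum, integral_finsetSum]
  · refine Finset.sum_congr rfl fun i _ => ?_
    rw [integral_mul_fderiv_eq_neg hf (hφ' i) (hc' i),
      integral_mul_fderiv_eq_neg (hf' i) hφ hc, neg_neg]
  · exact fun i _ => ((contDiff_fderiv_apply_const (hf' i) _).continuous.mul
      hφ.continuous).integrable_of_hasCompactSupport hc.mul_left
  · exact fun i _ => (hf.continuous.mul
      (contDiff_fderiv_apply_const (hφ' i) _).continuous).integrable_of_hasCompactSupport
        ((hc' i).fderiv_apply (𝕜 := ℝ) _).mul_left

end LaplacianCalculus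

section WeakLaplacian

variable {E : Type*} [NormedAddCommGroup E] [InnerProductSpace ℝ E] [FiniteDimensional ℝ E]
  [MeasurableSpace E] [BorelSpace E]

theorem integrable_mul_of_locallyIntegrable {f φ : E → ℝ} (hf : LocallyIntegrable f volume)
    (hφ : Continuous φ) (hc : HasCompactSupport φ) : Integrable (fun x => f x * φ x) :=
  hf.integrable_smul_right_of_hasCompactSupport hφ hc

/-- `Δ u = f` in the sense of distributions. -/
structure HasWeakLaplacian (u f : E → ℝ) : Prop where
  locallyIntegrable : LocallyIntegrable u volume
  locallyIntegrable_laplacian : LocallyIntegrable f volume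
  integral_mul_laplacian : ∀ φ : E → ℝ, ContDiff ℝ ∞ φ → HasCompactSupport φ →
    ∫ x, u x * Δ φ x = ∫ x, f x * φ x

theorem solvesPoisson_iff_hasWeakLaplacian_neg {u f : Plane → ℝ} :
    SolvesPoisson u f ↔ HasWeakLaplacian u (fun x => -f x) := by
  have weak (φ : Plane → ℝ) : -∫ x, u x * Δ φ x = ∫ x, f x * φ x ↔
      ∫ x, u x * Δ φ x = ∫ x, -f x * φ x := by
    simp only [neg_mul, integral_neg]
    exact neg_eq_iff_eq_neg
  constructor
  · rintro ⟨hu, hf, h⟩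
    exact ⟨hu, hf.neg, fun φ hφ hc => (weak φ).1 (h φ hφ hc)⟩
  · rintro ⟨hu, hf, h⟩
    exact ⟨hu, by simpa [Pi.neg_def] using hf.neg, fun φ hφ hc => (weak φ).2 (h φ hφ hc)⟩

theorem hasWeakLaplacian_of_contDiff {u : E → ℝ} (hu : ContDiff ℝ ∞ u) :
    HasWeakLaplacian u (Δ u) :=
  ⟨hu.continuous.locallyIntegrable, (contDiff_laplacian hu).continuous.locallyIntegrable,
    fun _ hφ hc => integral_mul_laplacian hu hφ hc⟩

namespace HasWeakLaplacian

variable {u u' f f' ψ φ : E → ℝ}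

theorem add (h : HasWeakLaplacian u f) (h' : HasWeakLaplacian u' f') :
    HasWeakLaplacian (fun x => u x + u' x) (fun x => f x + f' x) := by
  refine ⟨h.1.add h'.1, h.2.add h'.2, fun φ hφ hc => ?_⟩
  have hΔ := (contDiff_laplacian hφ).continuous
  have hΔc := hasCompactSupport_laplacian hc
  simp only [add_mul]
  rw [integral_add (integrable_mul_of_locallyIntegrable h.1 hΔ hΔc)
      (integrable_mul_of_locallyIntegrable h'.1 hΔ hΔc),
    integral_add (integrable_mul_of_locallyIntegrable h.2 hφ.continuous hc)
      (integrable_mul_of_locallyIntegrable h'.2 hφ.continuous hc), h.3 φ hφ hc, h'.3 φ hφ hc]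

theorem const_mul (h : HasWeakLaplacian u f) (a : ℝ) :
    HasWeakLaplacian (fun x => a * u x) (fun x => a * f x) := by
  refine ⟨h.1.smul a, h.2.smul a, fun φ hφ hc => ?_⟩
  simp only [mul_assoc, integral_const_mul]
  rw [h.3 φ hφ hc]

theorem sub (h : HasWeakLaplacian u f) (h' : HasWeakLaplacian u' f') :
    HasWeakLaplacian (fun x => u x - u' x) (fun x => f x - f' x) := by
  simpa only [neg_one_mul, ← sub_eq_add_neg] using h.add (h'.const_mul (-1))

theorem congr_ae (h : HasWeakLaplacian u f) (hu : u =ᵐ[volume] u') (hf : f =ᵐ[volume] f') :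
    HasWeakLaplacian u' f' := by
  refine ⟨h.1.congr hu, h.2.congr hf, fun φ hφ hc => ?_⟩
  calc ∫ x, u' x * Δ φ x = ∫ x, u x * Δ φ x := integral_congr_ae (hu.symm.mul (.refl _ (Δ φ)))
    _ = ∫ x, f x * φ x := h.3 φ hφ hc
    _ = ∫ x, f' x * φ x := integral_congr_ae (hf.mul (.refl _ φ))

end HasWeakLaplacian

end WeakLaplacian

section ShrinkingBump

variable (E : Type*) [NormedAddCommGroup E]

/-- The smooth bumps whose normalizations are the mollifiers used throughout. -/
noncomputable def shrinkingBump (n : ℕ) :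
    ContDiffBump (0 : E) where
  rIn := 1 / (n + 1)
  rOut := 2 / (n + 1)
  rIn_pos := by positivity
  rIn_lt_rOut := by gcongr; norm_num

theorem tendsto_rOut_shrinkingBump : Tendsto (fun n => (shrinkingBump E n).rOut) atTop (𝓝 0) :=
  ((tendsto_const_div_atTop_nhds_zero_nat (2 : ℝ)).comp (tendsto_add_atTop_nat 1)).congr
    fun n => by simp [shrinkingBump]

theorem rOut_shrinkingBump_le (n : ℕ) : (shrinkingBump E n).rOut ≤ 2 :=
  div_le_self zero_le_two (by linarith [n.cast_nonneg (α := ℝ)])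

end ShrinkingBump

section Mollification

variable {E : Type*} [NormedAddCommGroup E] [InnerProductSpace ℝ E] [FiniteDimensional ℝ E]
  [MeasurableSpace E] [BorelSpace E] {u f ψ : E → ℝ}

theorem convolution_real_comm (f g : E → ℝ) : f ⋆ g = g ⋆ f := by
  ext x
  rw [convolution_lsmul_swap, convolution_lsmul]
  simp only [smul_eq_mul, mul_comm]

theorem sub_convolution_apply {f f' g : E → ℝ} {x : E}
    (h : ConvolutionExistsAt f g x (ContinuousLinearMap.lsmul ℝ ℝ))
    (h' : ConvolutionExistsAt f' g x (ContinuousLinearMap.lsmul ℝ ℝ)) :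
    ((f - f') ⋆ g) x = (f ⋆ g) x - (f' ⋆ g) x := by
  simp only [convolution_lsmul, Pi.sub_apply, sub_smul]
  exact integral_sub h h'

theorem convolution_sub_apply {f g g' : E → ℝ} {x : E}
    (h : ConvolutionExistsAt f g x (ContinuousLinearMap.lsmul ℝ ℝ))
    (h' : ConvolutionExistsAt f g' x (ContinuousLinearMap.lsmul ℝ ℝ)) :
    (f ⋆ (g - g')) x = (f ⋆ g) x - (f ⋆ g') x := by
  simp only [convolution_lsmul, Pi.sub_apply, smul_sub]
  exact integral_sub h h'

theorem contDiff_convolution (hψ : ContDiff ℝ ∞ ψ) (hc : HasCompactSupport ψ)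
    (hf : LocallyIntegrable f volume) : ContDiff ℝ ∞ (ψ ⋆ f) :=
  hc.contDiff_convolution_left _ hψ hf

theorem fderiv_convolution_apply (hψ : ContDiff ℝ ∞ ψ) (hc : HasCompactSupport ψ)
    (hf : LocallyIntegrable f volume) (x v : E) :
    fderiv ℝ (ψ ⋆ f) x v = ((fun z => fderiv ℝ ψ z v) ⋆ f) x := by
  rw [convolution_real_comm ψ, convolution_real_comm _ f, (hc.hasFDerivAt_convolution_right _ hf
    (hψ.of_le (by norm_cast)) x).fderiv, convolution_precompR_apply _ hf (hc.fderiv ℝ)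
    (hψ.continuous_fderiv (by simp))]

theorem laplacian_convolution (hψ : ContDiff ℝ ∞ ψ) (hc : HasCompactSupport ψ)
    (hf : LocallyIntegrable f volume) : Δ (ψ ⋆ f) = Δ ψ ⋆ f := by
  let b := stdOrthonormalBasis ℝ E
  have hψ' (i) := contDiff_fderiv_apply_const hψ (b i)
  have hc' (i) : HasCompactSupport (fun x => fderiv ℝ ψ x (b i)) := hc.fderiv_apply (𝕜 := ℝ) _
  ext x
  rw [laplacian_eq_sum_fderiv_of_contDiff b (contDiff_convolution hψ hc hf),
    laplacian_eq_sum_fderiv_of_contDiff b hψ]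
  have hfun (i) : (fun y => fderiv ℝ (ψ ⋆ f) y (b i)) = (fun z => fderiv ℝ ψ z (b i)) ⋆ f :=
    funext fun y => fderiv_convolution_apply hψ hc hf y (b i)
  simp only [hfun, fderiv_convolution_apply (hψ' _) (hc' _) hf, convolution_lsmul_swap,
    smul_eq_mul, Finset.sum_mul]
  refine (integral_finsetSum _ fun i _ => ?_).symm
  exact hf.integrable_smul_left_of_hasCompactSupport
    (g := fun t => fderiv ℝ (fun y => fderiv ℝ ψ y (b i)) (x - t) (b i))
    ((contDiff_fderiv_apply_const (hψ' i) (b i)).continuous.comp (by fun_prop))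
    (((hc' i).fderiv_apply (𝕜 := ℝ) (b i)).comp_homeomorph (Homeomorph.subLeft x))

theorem HasWeakLaplacian.laplacian_convolution_eq (h : HasWeakLaplacian u f) (hψ : ContDiff ℝ ∞ ψ)
    (hc : HasCompactSupport ψ) : Δ ψ ⋆ u = ψ ⋆ f := by
  ext x
  have hΔ (y : E) : Δ (fun y : E => ψ (x - y)) y = Δ ψ (x - y) := by
    simpa [← sub_eq_add_neg] using laplacian_comp_const_add_smul hψ x (-1) y
  have test := h.integral_mul_laplacian (fun y => ψ (x - y))
    (hψ.comp (contDiff_const.sub contDiff_id)) (hc.comp_homeomorph (Homeomorph.subLeft x))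
  simpa only [hΔ, convolution_lsmul_swap, smul_eq_mul, mul_comm] using test

theorem HasWeakLaplacian.laplacian_convolution (h : HasWeakLaplacian u f) (hψ : ContDiff ℝ ∞ ψ)
    (hc : HasCompactSupport ψ) : Δ (ψ ⋆ u) = ψ ⋆ f := by
  rw [_root_.laplacian_convolution hψ hc h.1, h.laplacian_convolution_eq hψ hc]

theorem abs_convolution_le {C : ℝ} {x : E} (hψ : Integrable ψ)
    (hC : ∀ y, ψ (x - y) ≠ 0 → |f y| ≤ C) : |(ψ ⋆ f) x| ≤ C * ∫ z, |ψ z| := by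
  rw [convolution_lsmul_swap, ← integral_sub_left_eq_self (fun z => |ψ z|) _ x,
    ← integral_const_mul]
  refine norm_integral_le_of_norm_le (f := fun y => ψ (x - y) • f y)
    ((hψ.abs.comp_sub_left x).const_mul C) (.of_forall fun y => ?_)
  rw [Real.norm_eq_abs, smul_eq_mul, abs_mul, mul_comm]
  by_cases hy : ψ (x - y) = 0
  · simp [hy]
  · exact mul_le_mul_of_nonneg_right (hC y hy) (abs_nonneg _)

theorem abs_convolution_normed_le (b : ContDiffBump (0 : E)) {C : ℝ} {x : E}
    (hC : ∀ y, ‖y - x‖ < b.rOut → |f y| ≤ C) : |(b.normed volume ⋆ f) x| ≤ C := by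
  have hint : ∫ z, |b.normed volume z| = 1 := by
    simp only [abs_of_nonneg (b.nonneg_normed _), b.integral_normed]
  rw [← mul_one C, ← hint]
  refine abs_convolution_le b.integrable_normed fun y hy => hC y ?_
  have : x - y ∈ Function.support (b.normed volume) := hy
  rw [b.support_normed_eq, mem_ball_zero_iff] at this
  rwa [norm_sub_rev]

theorem ae_tendsto_convolution_shrinkingBump (hf : LocallyIntegrable f volume) :
    ∀ᵐ x, Tendsto (fun n => ((shrinkingBump E n).normed volume ⋆ f) x) atTop (𝓝 (f x)) :=
  ContDiffBump.ae_convolution_tendsto_right_of_locallyIntegrable (K := 2)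
    (tendsto_rOut_shrinkingBump E)
    (.of_forall fun _ => (mul_one_div _ _).ge) hf

theorem tendsto_integral_mul_of_ae_tendsto {g : ℕ → E → ℝ} {φ : E → ℝ} {B : ℝ}
    (hφ : Continuous φ) (hc : HasCompactSupport φ) (hg : ∀ n, AEStronglyMeasurable (g n) volume)
    (hB : ∀ n x, φ x ≠ 0 → |g n x| ≤ B)
    (hlim : ∀ᵐ x, Tendsto (fun n => g n x) atTop (𝓝 (f x))) :
    Tendsto (fun n => ∫ x, g n x * φ x) atTop (𝓝 (∫ x, f x * φ x)) := by
  refine tendsto_integral_of_dominated_convergence (fun x => B * |φ x|)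
    (fun n => (hg n).mul hφ.aestronglyMeasurable)
    ((hφ.integrable_of_hasCompactSupport hc).abs.const_mul B)
    (fun n => .of_forall fun x => (norm_mul _ _).trans_le ?_)
    (hlim.mono fun x hx => hx.mul_const _)
  by_cases hx : φ x = 0
  · simp [hx]
  · exact mul_le_mul_of_nonneg_right (hB n x hx) (abs_nonneg _)

theorem two_mul_integral_mul_laplacian_le {w φ : E → ℝ} (hw : ContDiff ℝ ∞ w)
    (hφ : ContDiff ℝ ∞ φ) (hc : HasCompactSupport φ) (hφ0 : ∀ x, 0 ≤ φ x) :
    2 * ∫ x, w x * Δ w x * φ x ≤ ∫ x, w x ^ 2 * Δ φ x := by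
  have hsq : ContDiff ℝ ∞ (fun x => w x ^ 2) := hw.pow 2
  have hΔw := (contDiff_laplacian hw).continuous
  rw [integral_mul_laplacian hsq hφ hc, ← integral_const_mul]
  refine integral_mono ?_ ?_ fun x => ?_
  · exact (((hw.continuous.mul hΔw).mul hφ.continuous).integrable_of_hasCompactSupport
      hc.mul_left).const_mul 2
  · exact ((contDiff_laplacian hsq).continuous.mul
      hφ.continuous).integrable_of_hasCompactSupport hc.mul_left
  · have hgrad : 0 ≤ 2 * ‖fderiv ℝ w x‖ ^ 2 * φ x := mul_nonneg (by positivity) (hφ0 x)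
    simp only [laplacian_sq (hw.of_le (by norm_cast : (2 : ℕ∞ω) ≤ ∞)).contDiffAt]
    linarith

namespace HasWeakLaplacian

variable {w F φ : E → ℝ} {C : ℝ}

theorem two_mul_integral_le (h : HasWeakLaplacian w F) (hw : ∀ x, |w x| ≤ C)
    (hF : ∀ R, ∃ M, ∀ x, ‖x‖ ≤ R → |F x| ≤ M) (hφ : ContDiff ℝ ∞ φ) (hc : HasCompactSupport φ)
    (hφ0 : ∀ x, 0 ≤ φ x) : 2 * ∫ x, w x * F x * φ x ≤ ∫ x, w x ^ 2 * Δ φ x := by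
  obtain ⟨R, hR⟩ := hc.isCompact.isBounded.subset_closedBall (0 : E)
  obtain ⟨M, hM⟩ := hF (R + 2)
  let κ (n : ℕ) := (shrinkingBump E n).normed volume
  have hκ (n : ℕ) : ContDiff ℝ ∞ (κ n) := (shrinkingBump E n).contDiff_normed
  have hκc (n : ℕ) : HasCompactSupport (κ n) := (shrinkingBump E n).hasCompactSupport_normed
  have hW (n : ℕ) : ContDiff ℝ ∞ (κ n ⋆ w) := contDiff_convolution (hκ n) (hκc n) h.1
  have hG (n : ℕ) : ContDiff ℝ ∞ (κ n ⋆ F) := contDiff_convolution (hκ n) (hκc n) h.2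
  have hWC (n : ℕ) (x : E) : |(κ n ⋆ w) x| ≤ C := abs_convolution_normed_le _ fun y _ => hw y
  have hGM (n : ℕ) (x : E) (hx : φ x ≠ 0) : |(κ n ⋆ F) x| ≤ M := by
    refine abs_convolution_normed_le _ fun y hy => hM y ?_
    have hxR : ‖x‖ ≤ R := by simpa using hR (subset_tsupport _ hx)
    linarith [norm_le_norm_add_norm_sub' y x, rOut_shrinkingBump_le E n]
  have hWlim := ae_tendsto_convolution_shrinkingBump h.1
  have smooth (n : ℕ) :
      2 * ∫ x, (κ n ⋆ w) x * (κ n ⋆ F) x * φ x ≤ ∫ x, (κ n ⋆ w) x ^ 2 * Δ φ x := by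
    rw [← h.laplacian_convolution (hκ n) (hκc n)]
    exact two_mul_integral_mul_laplacian_le (hW n) hφ hc hφ0
  have lim_left : Tendsto (fun n => ∫ x, (κ n ⋆ w) x * (κ n ⋆ F) x * φ x) atTop
      (𝓝 (∫ x, w x * F x * φ x)) := by
    refine tendsto_integral_mul_of_ae_tendsto (B := C * M) hφ.continuous hc
      (fun n => ((hW n).continuous.mul (hG n).continuous).aestronglyMeasurable)
      (fun n x hx => (abs_mul _ _).trans_le ?_) ?_
    · exact mul_le_mul (hWC n x) (hGM n x hx) (abs_nonneg _) ((abs_nonneg _).trans (hWC n x))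
    · filter_upwards [hWlim, ae_tendsto_convolution_shrinkingBump h.2] with x hw hF using hw.mul hF
  have lim_right : Tendsto (fun n => ∫ x, (κ n ⋆ w) x ^ 2 * Δ φ x) atTop
      (𝓝 (∫ x, w x ^ 2 * Δ φ x)) :=
    tendsto_integral_mul_of_ae_tendsto (B := C ^ 2) (contDiff_laplacian hφ).continuous
      (hasCompactSupport_laplacian hc)
      (fun n => ((hW n).continuous.pow 2).aestronglyMeasurable)
      (fun n x _ => (abs_pow _ _).trans_le (pow_le_pow_left₀ (abs_nonneg _) (hWC n x) 2))
      (hWlim.mono fun x hx => hx.pow 2)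
  exact le_of_tendsto_of_tendsto' (lim_left.const_mul 2) lim_right smooth

end HasWeakLaplacian

end Mollification

section LogarithmicCutoff

theorem laplacian_comp_log_norm {E : Type*} [NormedAddCommGroup E] [InnerProductSpace ℝ E]
    [FiniteDimensional ℝ E] {β : ℝ → ℝ} {x : E} (hx : x ≠ 0)
    (hβ : ContDiffAt ℝ 2 β (Real.log ‖x‖)) :
    Δ (fun y : E => β (Real.log ‖y‖)) x = (deriv (deriv β) (Real.log ‖x‖) +
      (Module.finrank ℝ E - 2) * deriv β (Real.log ‖x‖)) / ‖x‖ ^ 2 := by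
  have hx2 : ‖x‖ ^ 2 ≠ 0 := by positivity
  have hlog (y : E) : Real.log ‖y‖ = Real.log (‖y‖ ^ 2) / 2 := by simp
  have hsmooth : ContDiffAt ℝ 2 (fun s => Real.log s / 2) (‖x‖ ^ 2) :=
    (Real.contDiffAt_log.2 hx2).div_const 2
  have hgrad : ‖fderiv ℝ (fun y : E => Real.log (‖y‖ ^ 2) / 2) x‖ ^ 2 = (‖x‖ ^ 2)⁻¹ := by
    have hd := ((Real.hasDerivAt_log hx2).div_const 2).comp_hasFDerivAt x
      (hasStrictFDerivAt_norm_sq x).hasFDerivAt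
    have hd : HasFDerivAt (fun y : E => Real.log (‖y‖ ^ 2) / 2) _ x := hd
    rw [hd.fderiv, ← Nat.cast_smul_eq_nsmul ℝ, norm_smul, norm_smul, innerSL_apply_norm]
    simp only [norm_div, norm_inv, norm_pow, norm_norm, Real.norm_ofNat, Nat.cast_ofNat]
    field_simp
  have hlap : Δ (fun y : E => Real.log (‖y‖ ^ 2) / 2) x = (Module.finrank ℝ E - 2) / ‖x‖ ^ 2 := by
    have hd : deriv (fun s => Real.log s / 2) = fun s => s⁻¹ / 2 := by ext s; simp
    rw [laplacian_comp_norm_sq hsmooth, hd, deriv_div_const, deriv_inv]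
    field_simp
    ring
  simp only [hlog] at hβ ⊢
  rw [laplacian_comp (f := fun y => Real.log (‖y‖ ^ 2) / 2)
    (hsmooth.comp x (contDiff_norm_sq ℝ).contDiffAt) hβ, hgrad, hlap]
  field_simp

theorem integral_comp_log_norm_div_norm_sq (β : ℝ → ℝ) :
    ∫ x : Plane, β (Real.log ‖x‖) / ‖x‖ ^ 2 = 2 * Real.pi * ∫ s, β s := by
  have polar : ∫ x : Plane, β (Real.log ‖x‖) / ‖x‖ ^ 2 =
      2 * Real.pi * ∫ r in Set.Ioi (0 : ℝ), r * (β (Real.log r) / r ^ 2) := by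
    rw [integral_fun_norm_addHaar (volume : Measure Plane) fun r => β (Real.log r) / r ^ 2]
    simp [measureReal_def, EuclideanSpace.volume_ball_fin_two, mul_assoc, Real.pi_pos.le]
  have exp_subst := integral_image_eq_integral_abs_deriv_smul MeasurableSet.univ
    (fun s _ => (Real.hasDerivAt_exp s).hasDerivWithinAt) Real.exp_injective.injOn
    (fun r => r * (β (Real.log r) / r ^ 2))
  rw [polar, ← Real.range_exp, ← Set.image_univ, exp_subst, setIntegral_univ]
  congr 2 with s
  rw [abs_of_pos (Real.exp_pos s), Real.log_exp, smul_eq_mul]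
  field_simp [Real.exp_ne_zero]

/-- A smooth transition from `1` on `(-∞, 1]` to `0` on `[2, ∞)`. -/
noncomputable def cutoffProfile (s : ℝ) : ℝ := Real.smoothTransition (2 - s)

theorem contDiff_cutoffProfile : ContDiff ℝ ∞ cutoffProfile :=
  Real.smoothTransition.contDiff.comp (contDiff_const.sub contDiff_id)

theorem cutoffProfile_of_le {s : ℝ} (h : s ≤ 1) : cutoffProfile s = 1 :=
  Real.smoothTransition.one_of_one_le (by linarith)

theorem cutoffProfile_of_ge {s : ℝ} (h : 2 ≤ s) : cutoffProfile s = 0 :=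
  Real.smoothTransition.zero_of_nonpos (by linarith)

theorem contDiff_deriv_cutoffProfile : ContDiff ℝ ∞ (deriv cutoffProfile) :=
  (contDiff_infty_iff_deriv.1 contDiff_cutoffProfile).2

theorem deriv_cutoffProfile_of_notMem {s : ℝ} (hs : s ∉ Set.Icc (1 : ℝ) 2) :
    deriv cutoffProfile s = 0 := by
  rw [Set.mem_Icc, not_and_or, not_le, not_le] at hs
  have : ∃ c : ℝ, cutoffProfile =ᶠ[𝓝 s] fun _ => c := by
    rcases hs with h | h
    · exact ⟨1, (eventually_lt_nhds h).mono fun r hr => cutoffProfile_of_le hr.le⟩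
    · exact ⟨0, (eventually_gt_nhds h).mono fun r hr => cutoffProfile_of_ge hr.le⟩
  obtain ⟨c, hc⟩ := this
  rw [hc.deriv_eq, deriv_const]

theorem hasCompactSupport_deriv_cutoffProfile : HasCompactSupport (deriv cutoffProfile) :=
  .intro isCompact_Icc fun _ => deriv_cutoffProfile_of_notMem

theorem integral_mul_deriv_deriv_cutoffProfile : ∫ s, s * deriv (deriv cutoffProfile) s = 1 := by
  have hderiv (s : ℝ) : HasDerivAt (fun s => s * deriv cutoffProfile s - cutoffProfile s)
      (s * deriv (deriv cutoffProfile) s) s := by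
    have hχ := (contDiff_cutoffProfile.differentiable (by simp) s).hasDerivAt
    have hχ' := (contDiff_deriv_cutoffProfile.differentiable (by simp) s).hasDerivAt
    exact (((hasDerivAt_id s).mul hχ').sub hχ).congr_deriv (by simp)
  have hint : Integrable (fun s => s * deriv (deriv cutoffProfile) s) :=
    (continuous_id.mul (contDiff_deriv_cutoffProfile.continuous_deriv
      (by simp))).integrable_of_hasCompactSupport
      hasCompactSupport_deriv_cutoffProfile.deriv.mul_left
  have hbot : Tendsto (fun s => s * deriv cutoffProfile s - cutoffProfile s) atBot (𝓝 (-1)) := by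
    refine tendsto_const_nhds.congr' ((eventually_lt_atBot 1).mono fun s hs => ?_)
    simp [deriv_cutoffProfile_of_notMem (fun h => hs.not_ge h.1), cutoffProfile_of_le hs.le]
  have htop : Tendsto (fun s => s * deriv cutoffProfile s - cutoffProfile s) atTop (𝓝 0) := by
    refine tendsto_const_nhds.congr' ((eventually_gt_atTop 2).mono fun s hs => ?_)
    simp [deriv_cutoffProfile_of_notMem (fun h => hs.not_ge h.2), cutoffProfile_of_ge hs.le]
  rw [integral_of_hasDerivAt_of_tendsto hderiv hint hbot htop]
  norm_num

/-- The logarithmic cutoff: `1` on `‖x‖ ≤ exp L` and `0` on `exp (2 * L) ≤ ‖x‖`. The value at the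
origin is `1` because `Real.log 0 = 0`. -/
noncomputable def logCutoff (L : ℝ) (x : Plane) : ℝ := cutoffProfile (Real.log ‖x‖ / L)

theorem logCutoff_nonneg (L : ℝ) (x : Plane) : 0 ≤ logCutoff L x :=
  Real.smoothTransition.nonneg _

theorem logCutoff_le_one (L : ℝ) (x : Plane) : logCutoff L x ≤ 1 :=
  Real.smoothTransition.le_one _

variable {L : ℝ} {x : Plane}

theorem logCutoff_eq_one (hL : 0 < L) (hx : ‖x‖ ≤ Real.exp L) : logCutoff L x = 1 := by
  refine cutoffProfile_of_le ((div_le_one hL).2 ?_)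
  rcases eq_or_ne x 0 with rfl | h
  · simpa using hL.le
  · exact (Real.log_le_iff_le_exp (norm_pos_iff.2 h)).2 hx

theorem logCutoff_eq_zero (hL : 0 < L) (hx : Real.exp (2 * L) ≤ ‖x‖) : logCutoff L x = 0 :=
  cutoffProfile_of_ge ((le_div_iff₀ hL).2
    ((Real.le_log_iff_exp_le ((Real.exp_pos _).trans_le hx)).2 hx))

theorem logCutoff_eventuallyEq_one (hL : 0 < L) (hx : ‖x‖ < Real.exp L) :
    logCutoff L =ᶠ[𝓝 x] fun _ => 1 :=
  (continuous_norm.continuousAt.eventually_lt continuousAt_const hx).mono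
    fun _ hy => logCutoff_eq_one hL hy.le

theorem contDiff_logCutoff (hL : 0 < L) : ContDiff ℝ ∞ (logCutoff L) := by
  refine contDiff_iff_contDiffAt.2 fun x => ?_
  rcases eq_or_ne x 0 with rfl | hx
  · exact contDiffAt_const.congr_of_eventuallyEq
      (logCutoff_eventuallyEq_one hL (by simpa using Real.exp_pos L))
  · exact contDiff_cutoffProfile.contDiffAt.comp x
      (((contDiffAt_norm ℝ hx).log (norm_ne_zero_iff.2 hx)).div_const L)

theorem hasCompactSupport_logCutoff (hL : 0 < L) : HasCompactSupport (logCutoff L) :=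
  .intro (isCompact_closedBall 0 (Real.exp (2 * L))) fun x hx =>
    logCutoff_eq_zero hL (by simpa using (not_le.1 (mt mem_closedBall_zero_iff.2 hx)).le)

theorem laplacian_logCutoff_eq_zero (hL : 0 < L) (hx : ‖x‖ < Real.exp L) :
    Δ (logCutoff L) x = 0 :=
  laplacian_eq_zero_of_eventuallyEq_const (logCutoff_eventuallyEq_one hL hx)

theorem laplacian_logCutoff (hL : 0 < L) (x : Plane) :
    Δ (logCutoff L) x =
      deriv (deriv cutoffProfile) (Real.log ‖x‖ / L) / L ^ 2 / ‖x‖ ^ 2 := by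
  rcases eq_or_ne x 0 with rfl | hx
  · simp [laplacian_logCutoff_eq_zero (x := 0) hL (by simpa using Real.exp_pos L)]
  · have hβ : ContDiff ℝ 2 (fun s => cutoffProfile (s / L)) :=
      (contDiff_cutoffProfile.of_le (by norm_cast)).comp (contDiff_id.div_const L)
    have hd (f : ℝ → ℝ) : deriv (fun s => f (s / L)) = fun s => deriv f (s / L) / L := by
      ext s
      simpa [div_eq_inv_mul] using deriv_comp_mul_left L⁻¹ f s
    have := laplacian_comp_log_norm hx hβ.contDiffAt
    rw [show logCutoff L = fun y => cutoffProfile (Real.log ‖y‖ / L) from rfl, this, hd,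
      deriv_div_const, hd, finrank_euclideanSpace_fin]
    simp only [Nat.cast_ofNat, sub_self, zero_mul, add_zero]
    ring

theorem integral_abs_laplacian_logCutoff (hL : 0 < L) :
    ∫ x, |Δ (logCutoff L) x| = 2 * Real.pi * (∫ s, |deriv (deriv cutoffProfile) s|) / L := by
  simp only [laplacian_logCutoff hL, abs_div _ (‖_‖ ^ 2), abs_pow, abs_norm]
  rw [integral_comp_log_norm_div_norm_sq
    (fun s => |deriv (deriv cutoffProfile) (s / L) / L ^ 2|)]
  simp only [abs_div, integral_div, Measure.integral_comp_div (fun s =>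
    |deriv (deriv cutoffProfile) s|), abs_of_pos hL, smul_eq_mul, abs_pow]
  field_simp

theorem integral_log_mul_laplacian_logCutoff (hL : 0 < L) :
    ∫ x, Real.log ‖x‖ * Δ (logCutoff L) x = 2 * Real.pi := by
  have scale (s : ℝ) : s * (deriv (deriv cutoffProfile) (s / L) / L ^ 2) =
      L⁻¹ * (s / L * deriv (deriv cutoffProfile) (s / L)) := by ring
  simp only [laplacian_logCutoff hL, ← mul_div_assoc _ _ (‖_‖ ^ 2)]
  rw [integral_comp_log_norm_div_norm_sq
    (fun s => s * (deriv (deriv cutoffProfile) (s / L) / L ^ 2))]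
  simp only [scale, integral_const_mul, Measure.integral_comp_div (fun s =>
    s * deriv (deriv cutoffProfile) s), integral_mul_deriv_deriv_cutoffProfile, abs_of_pos hL,
    smul_eq_mul, mul_one, inv_mul_cancel₀ hL.ne']

end LogarithmicCutoff

section Plane

namespace IsLocallyBounded

variable {f g : Plane → ℝ}

theorem locallyIntegrable (hb : IsLocallyBounded f) (hm : AEStronglyMeasurable f volume) :
    LocallyIntegrable f volume := by
  refine locallyIntegrable_iff.2 fun k hk => ?_
  obtain ⟨R, hR⟩ := hk.isBounded.subset_closedBall (0 : Plane)
  obtain ⟨M, hM⟩ := hb R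
  refine Measure.integrableOn_of_bounded (M := M) hk.measure_lt_top.ne hm ?_
  filter_upwards [ae_restrict_mem hk.measurableSet] with x hx
  exact hM x (mem_closedBall_zero_iff.1 (hR hx))

theorem of_continuous (hg : Continuous g) : IsLocallyBounded g := fun R =>
  let ⟨C, hC⟩ := (isCompact_closedBall (0 : Plane) R).exists_bound_of_continuousOn hg.continuousOn
  ⟨C, fun x hx => hC x (mem_closedBall_zero_iff.2 hx)⟩

theorem mul (hf : IsLocallyBounded f) (hg : IsLocallyBounded g) :
    IsLocallyBounded (fun x => f x * g x) := fun R =>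
  let ⟨A, hA⟩ := hf R
  let ⟨B, hB⟩ := hg R
  ⟨A * B, fun x hx => (abs_mul _ _).trans_le
    (mul_le_mul (hA x hx) (hB x hx) (abs_nonneg _) ((abs_nonneg _).trans (hA x hx)))⟩

theorem neg (hf : IsLocallyBounded f) : IsLocallyBounded (fun x => -f x) := fun R =>
  let ⟨A, hA⟩ := hf R
  ⟨A, fun x hx => (abs_neg _).trans_le (hA x hx)⟩

end IsLocallyBounded

section Parabolicity

variable {g : Plane → ℝ} {C R L : ℝ}

theorem norm_mul_laplacian_logCutoff_le (hL : 0 < L) (hRL : R < Real.exp L)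
    (hC : ∀ x, R < ‖x‖ → |g x| ≤ C) (x : Plane) :
    ‖g x * Δ (logCutoff L) x‖ ≤ C * |Δ (logCutoff L) x| := by
  rw [Real.norm_eq_abs, abs_mul]
  rcases lt_or_ge ‖x‖ (Real.exp L) with h | h
  · simp [laplacian_logCutoff_eq_zero hL h]
  · exact mul_le_mul_of_nonneg_right (hC x (hRL.trans_le h)) (abs_nonneg _)

theorem integrable_laplacian_logCutoff (hL : 0 < L) : Integrable (Δ (logCutoff L)) :=
  (contDiff_laplacian (contDiff_logCutoff hL)).continuous.integrable_of_hasCompactSupport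
    (hasCompactSupport_laplacian (hasCompactSupport_logCutoff hL))

theorem integrable_mul_laplacian_logCutoff (hL : 0 < L) (hRL : R < Real.exp L)
    (hg : AEStronglyMeasurable g volume) (hC : ∀ x, R < ‖x‖ → |g x| ≤ C) :
    Integrable (fun x => g x * Δ (logCutoff L) x) :=
  ((integrable_laplacian_logCutoff hL).abs.const_mul C).mono'
    (hg.mul (integrable_laplacian_logCutoff hL).aestronglyMeasurable)
    (.of_forall (norm_mul_laplacian_logCutoff_le hL hRL hC))

theorem tendsto_integral_mul_laplacian_logCutoff (hC : ∀ x, R < ‖x‖ → |g x| ≤ C) :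
    Tendsto (fun L : ℝ => ∫ x, g x * Δ (logCutoff L) x) atTop (𝓝 0) := by
  set M := ∫ s, |deriv (deriv cutoffProfile) s|
  have hlim : Tendsto (fun L : ℝ => C * (2 * Real.pi * M / L)) atTop (𝓝 0) := by
    simpa using (tendsto_id.const_div_atTop (2 * Real.pi * M)).const_mul C
  refine squeeze_zero_norm' ?_ hlim
  filter_upwards [Real.tendsto_exp_atTop.eventually_gt_atTop R, eventually_gt_atTop 0] with L hRL hL
  rw [← integral_abs_laplacian_logCutoff hL, ← integral_const_mul]
  exact norm_integral_le_of_norm_le ((integrable_laplacian_logCutoff hL).abs.const_mul C)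
    (.of_forall (norm_mul_laplacian_logCutoff_le hL hRL hC))

theorem integrable_mul_logCutoff (hg : LocallyIntegrable g volume) (hL : 0 < L) :
    Integrable (fun x => g x * logCutoff L x) :=
  integrable_mul_of_locallyIntegrable hg (contDiff_logCutoff hL).continuous
    (hasCompactSupport_logCutoff hL)

theorem integrable_of_tendsto_integral_mul_logCutoff {ℓ : ℝ} (hg : LocallyIntegrable g volume)
    (h0 : ∀ x, 0 ≤ g x) (hlim : Tendsto (fun L : ℝ => ∫ x, g x * logCutoff L x) atTop (𝓝 ℓ)) :
    Integrable g := by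
  refine (aecover_closedBall (x := (0 : Plane))
    Real.tendsto_exp_atTop).integrable_of_integral_bounded_of_nonneg_ae (ℓ + 1)
    (fun L => hg.integrableOn_isCompact (isCompact_closedBall _ _)) (.of_forall h0) ?_
  filter_upwards [hlim.eventually_le_const (lt_add_one ℓ), eventually_gt_atTop 0] with L hle hL
  calc ∫ x in Metric.closedBall 0 (Real.exp L), g x
      = ∫ x in Metric.closedBall 0 (Real.exp L), g x * logCutoff L x :=
        setIntegral_congr_fun Metric.isClosed_closedBall.measurableSet fun x hx => by
          rw [logCutoff_eq_one hL (mem_closedBall_zero_iff.1 hx), mul_one]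
    _ ≤ ∫ x, g x * logCutoff L x :=
        setIntegral_le_integral (integrable_mul_logCutoff hg hL)
          (.of_forall fun x => mul_nonneg (h0 x) (logCutoff_nonneg _ x))
    _ ≤ ℓ + 1 := hle

theorem tendsto_integral_mul_logCutoff (hg : Integrable g) :
    Tendsto (fun L : ℝ => ∫ x, g x * logCutoff L x) atTop (𝓝 (∫ x, g x)) := by
  refine tendsto_integral_filter_of_dominated_convergence (fun x => |g x|) ?_
    (.of_forall fun L => .of_forall fun x => ?_) hg.abs (.of_forall fun x => ?_)
  · filter_upwards [eventually_gt_atTop 0] with L hL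
    exact (integrable_mul_logCutoff hg.locallyIntegrable hL).aestronglyMeasurable
  · rw [Real.norm_eq_abs, abs_mul, abs_of_nonneg (logCutoff_nonneg _ x)]
    exact mul_le_of_le_one_right (abs_nonneg _) (logCutoff_le_one _ x)
  · refine tendsto_const_nhds.congr' ?_
    filter_upwards [Real.tendsto_exp_atTop.eventually_ge_atTop ‖x‖, eventually_gt_atTop 0]
      with L hx hL
    rw [logCutoff_eq_one hL hx, mul_one]

end Parabolicity

namespace HasWeakLaplacian

variable {u w F f : Plane → ℝ} {α R C : ℝ}

theorem tendsto_integral_mul_logCutoff_of_log_growth (h : HasWeakLaplacian u f)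
    (hu : ∀ x, R < ‖x‖ → |u x - α * Real.log ‖x‖| ≤ C) :
    Tendsto (fun L : ℝ => ∫ x, f x * logCutoff L x) atTop (𝓝 (2 * Real.pi * α)) := by
  have hm : AEStronglyMeasurable (fun x => u x - α * Real.log ‖x‖) (volume : Measure Plane) :=
    h.1.aestronglyMeasurable.sub
      ((Real.measurable_log.comp measurable_norm).const_mul α).aestronglyMeasurable
  have hlim := (tendsto_integral_mul_laplacian_logCutoff hu).add_const (2 * Real.pi * α)
  rw [zero_add] at hlim
  refine hlim.congr' ?_
  filter_upwards [Real.tendsto_exp_atTop.eventually_gt_atTop R, eventually_gt_atTop 0] with L hRL hL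
  have hφ := contDiff_logCutoff hL
  have hc := hasCompactSupport_logCutoff hL
  have hi := integrable_mul_of_locallyIntegrable h.1 (contDiff_laplacian hφ).continuous
    (hasCompactSupport_laplacian hc)
  rw [← h.3 _ hφ hc, ← eq_sub_iff_add_eq',
    ← integral_sub hi (integrable_mul_laplacian_logCutoff hL hRL hm hu),
    ← integral_log_mul_laplacian_logCutoff hL, mul_comm, ← integral_const_mul]
  exact integral_congr_ae (.of_forall fun x => by ring)

theorem integrable_of_log_growth (h : HasWeakLaplacian u f) (hf : ∀ x, 0 ≤ f x)
    (hu : ∀ x, R < ‖x‖ → |u x - α * Real.log ‖x‖| ≤ C) : Integrable f :=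
  integrable_of_tendsto_integral_mul_logCutoff h.2 hf
    (h.tendsto_integral_mul_logCutoff_of_log_growth hu)

theorem integral_eq_of_log_growth (h : HasWeakLaplacian u f) (hf : Integrable f)
    (hu : ∀ x, R < ‖x‖ → |u x - α * Real.log ‖x‖| ≤ C) : ∫ x, f x = 2 * Real.pi * α :=
  tendsto_nhds_unique (tendsto_integral_mul_logCutoff hf)
    (h.tendsto_integral_mul_logCutoff_of_log_growth hu)

theorem ae_eq_zero_of_bounded_of_nonneg (h : HasWeakLaplacian u f) (hu : ∀ x, |u x| ≤ C)
    (hf : ∀ x, 0 ≤ f x) : f =ᵐ[volume] 0 := by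
  have hu0 (x : Plane) (_ : 0 < ‖x‖) : |u x - 0 * Real.log ‖x‖| ≤ C := by simpa using hu x
  have hi := h.integrable_of_log_growth hf hu0
  exact (integral_eq_zero_iff_of_nonneg hf hi).1 (by simpa using h.integral_eq_of_log_growth hi hu0)

theorem mul_ae_eq_zero (h : HasWeakLaplacian w F) (hw : ∀ x, |w x| ≤ C) (hF : IsLocallyBounded F)
    (h0 : ∀ x, 0 ≤ w x * F x) : ∀ᵐ x, w x * F x = 0 := by
  have hwF : LocallyIntegrable (fun x => w x * F x) volume :=
    (IsLocallyBounded.mul (fun _ => ⟨C, fun x _ => hw x⟩) hF).locallyIntegrable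
      (h.1.aestronglyMeasurable.mul h.2.aestronglyMeasurable)
  have hsq (x : Plane) (_ : 0 < ‖x‖) : |w x ^ 2| ≤ C ^ 2 := by
    rw [abs_pow]
    exact pow_le_pow_left₀ (abs_nonneg _) (hw x) 2
  have hlim : Tendsto (fun L : ℝ => ∫ x, w x * F x * logCutoff L x) atTop (𝓝 0) := by
    have hsqlim := (tendsto_integral_mul_laplacian_logCutoff hsq).div_const 2
    rw [zero_div] at hsqlim
    refine squeeze_zero' (.of_forall fun L => integral_nonneg fun x =>
      mul_nonneg (h0 x) (logCutoff_nonneg _ x)) ?_ hsqlim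
    filter_upwards [eventually_gt_atTop 0] with L hL
    have := h.two_mul_integral_le hw hF (contDiff_logCutoff hL) (hasCompactSupport_logCutoff hL)
      (logCutoff_nonneg _)
    linarith
  have hi := integrable_of_tendsto_integral_mul_logCutoff hwF h0 hlim
  exact (integral_eq_zero_iff_of_nonneg h0 hi).1
    (tendsto_nhds_unique (tendsto_integral_mul_logCutoff hi) hlim)

end HasWeakLaplacian

theorem eq_of_bounded_of_laplacian_eq_zero {h : Plane → ℝ} {C : ℝ} (hh : ContDiff ℝ ∞ h)
    (hb : ∀ x, |h x| ≤ C) (hΔ : ∀ x, Δ h x = 0) (x y : Plane) : h x = h y := by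
  have hsq (x : Plane) : Δ (fun y => h y ^ 2) x = 2 * ‖fderiv ℝ h x‖ ^ 2 := by
    rw [laplacian_sq (hh.of_le (by norm_cast)).contDiffAt, hΔ, mul_zero, add_zero]
  have hae : Δ (fun y => h y ^ 2) =ᵐ[volume] 0 :=
    (hasWeakLaplacian_of_contDiff (hh.pow 2)).ae_eq_zero_of_bounded_of_nonneg (C := C ^ 2)
      (fun x => by
        rw [abs_pow]
        exact pow_le_pow_left₀ (abs_nonneg _) (hb x) 2)
      (fun x => by rw [hsq]; positivity)
  have hzero := (Continuous.ae_eq_iff_eq volume (contDiff_laplacian (hh.pow 2)).continuous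
    continuous_zero).1 hae
  refine is_const_of_fderiv_eq_zero (𝕜 := ℝ) (hh.differentiable (by simp)) (fun z => ?_) x y
  simpa [hsq] using congrFun hzero z

theorem HasWeakLaplacian.eq_of_bounded_of_ae_eq_zero {w F : Plane → ℝ} {C : ℝ}
    (h : HasWeakLaplacian w F) (hwc : Continuous w) (hw : ∀ x, |w x| ≤ C) (hF : F =ᵐ[volume] 0)
    (x y : Plane) : w x = w y := by
  let ψ (n : ℕ) : Plane → ℝ := (shrinkingBump Plane n).normed volume
  have hψ (n : ℕ) : ContDiff ℝ ∞ (ψ n) := (shrinkingBump Plane n).contDiff_normed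
  have hψc (n : ℕ) : HasCompactSupport (ψ n) := (shrinkingBump Plane n).hasCompactSupport_normed
  have hconst (n : ℕ) : (ψ n ⋆ w) x = (ψ n ⋆ w) y :=
    eq_of_bounded_of_laplacian_eq_zero (contDiff_convolution (hψ n) (hψc n) h.1)
      (fun z => abs_convolution_normed_le _ fun y _ => hw y)
      (fun z => by
        rw [(h.congr_ae .rfl hF).laplacian_convolution (hψ n) (hψc n)]
        simp [convolution]) x y
  have hlim (z : Plane) : Tendsto (fun n => (ψ n ⋆ w) z) atTop (𝓝 (w z)) :=
    ContDiffBump.convolution_tendsto_right_of_continuous (tendsto_rOut_shrinkingBump Plane) hwc z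
  exact tendsto_nhds_unique (hlim x) ((hlim y).congr fun n => (hconst n).symm)

theorem isBigO_cocompact_one_iff {g : Plane → ℝ} :
    g =O[cocompact Plane] (fun _ => (1 : ℝ)) ↔ ∃ R C : ℝ, ∀ x, R < ‖x‖ → |g x| ≤ C := by
  rw [← Metric.cobounded_eq_cocompact, isBigO_iff]
  constructor
  · rintro ⟨C, hC⟩
    obtain ⟨R, -, hR⟩ := hasBasis_cobounded_norm.eventually_iff.1 hC
    exact ⟨R, C, fun x hx => by simpa using hR hx.le⟩
  · rintro ⟨R, C, hC⟩
    exact ⟨C, hasBasis_cobounded_norm.eventually_iff.2 ⟨R + 1, trivial, fun x hx => by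
      simpa using hC x ((lt_add_one R).trans_le hx)⟩⟩

theorem exists_bound_of_continuous_of_isBigO {g : Plane → ℝ} (hg : Continuous g)
    (hO : g =O[cocompact Plane] (fun _ => (1 : ℝ))) : ∃ C, ∀ x, |g x| ≤ C := by
  obtain ⟨R, C, hC⟩ := isBigO_cocompact_one_iff.1 hO
  obtain ⟨C', hC'⟩ := IsLocallyBounded.of_continuous hg R
  refine ⟨max C C', fun x => ?_⟩
  rcases lt_or_ge R ‖x‖ with h | h
  · exact (hC x h).trans (le_max_left _ _)
  · exact (hC' x h).trans (le_max_right _ _)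

theorem sub_mul_exp_sub_exp_nonneg (a b : ℝ) :
    0 ≤ (a - b) * (Real.exp (2 * a) - Real.exp (2 * b)) := by
  have hmono : Monotone fun s : ℝ => Real.exp (2 * s) :=
    Real.exp_monotone.comp (monotone_id.const_mul two_pos.le)
  rcases le_total a b with h | h
  · exact mul_nonneg_of_nonpos_of_nonpos (sub_nonpos.2 h) (sub_nonpos.2 (hmono h))
  · exact mul_nonneg (sub_nonneg.2 h) (sub_nonneg.2 (hmono h))

namespace IsLogGrowthSolution

variable {K u u₁ u₂ : Plane → ℝ} {α : ℝ}

theorem integrable_and_integral_eq (hu : IsLogGrowthSolution K α u) (hK : ∀ x, K x ≤ 0) :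
    Integrable (fun x => K x * Real.exp (2 * u x)) ∧
      ∫ x, K x * Real.exp (2 * u x) = -2 * α * Real.pi := by
  obtain ⟨R, C, hC⟩ := isBigO_cocompact_one_iff.1 hu.2.2
  have hΔ := solvesPoisson_iff_hasWeakLaplacian_neg.1 hu.2.1
  have hi := hΔ.integrable_of_log_growth
    (fun x => neg_nonneg.2 (mul_nonpos_of_nonpos_of_nonneg (hK x) (Real.exp_pos _).le)) hC
  have hint := hΔ.integral_eq_of_log_growth hi hC
  rw [integral_neg] at hint
  exact ⟨integrable_neg_iff.1 hi, by linarith⟩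

theorem ae_eq_zero_or_eq (h₁ : IsLogGrowthSolution K α u₁) (h₂ : IsLogGrowthSolution K α u₂)
    (hK : ∀ x, K x ≤ 0) (hKb : IsLocallyBounded K) : (∀ᵐ x, K x = 0) ∨ u₁ = u₂ := by
  set w := fun x => u₁ x - u₂ x
  have hwc : Continuous w := h₁.1.sub h₂.1
  obtain ⟨C, hC⟩ := exists_bound_of_continuous_of_isBigO hwc
    ((h₁.2.2.sub h₂.2.2).congr_left fun x => sub_sub_sub_cancel_right _ _ _)
  have hw : HasWeakLaplacian w
      (fun x => -K x * (Real.exp (2 * u₁ x) - Real.exp (2 * u₂ x))) :=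
    ((solvesPoisson_iff_hasWeakLaplacian_neg.1 h₁.2.1).sub
      (solvesPoisson_iff_hasWeakLaplacian_neg.1 h₂.2.1)).congr_ae .rfl
      (.of_forall fun x => by ring)
  have hFb : IsLocallyBounded fun x => -K x * (Real.exp (2 * u₁ x) - Real.exp (2 * u₂ x)) :=
    hKb.neg.mul <| .of_continuous (by have := h₁.1; have := h₂.1; fun_prop)
  have hprod := hw.mul_ae_eq_zero hC hFb fun x => by
    rw [mul_left_comm]
    exact mul_nonneg (neg_nonneg.2 (hK x)) (sub_mul_exp_sub_exp_nonneg _ _)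
  have hzero : ∀ᵐ x, K x = 0 ∨ w x = 0 := hprod.mono fun x hx => by
    have hexp : Real.exp (2 * u₁ x) - Real.exp (2 * u₂ x) = 0 ↔ w x = 0 := by
      simp [sub_eq_zero, w]
    simpa [hexp, or_comm, or_left_comm] using hx
  have hconst := hw.eq_of_bounded_of_ae_eq_zero hwc hC <| hzero.mono fun x hx => by
    rcases hx with h | h
    · simp [h]
    · simp [sub_eq_zero.1 h]
  by_cases hw0 : w 0 = 0
  · exact .inr (funext fun x => sub_eq_zero.1 ((hconst x 0).trans hw0))
  · exact .inl (hzero.mono fun x hx => hx.resolve_right ((hconst 0 x).symm.trans_ne hw0))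

theorem unique (h₁ : IsLogGrowthSolution K α u₁) (h₂ : IsLogGrowthSolution K α u₂)
    (hK : ∀ x, K x ≤ 0) (hKb : IsLocallyBounded K) (hα : α ≠ 0) : u₁ = u₂ := by
  refine (h₁.ae_eq_zero_or_eq h₂ hK hKb).resolve_left fun hK0 => ?_
  have hmass := (h₁.integrable_and_integral_eq hK).2
  rw [integral_congr_ae (g := 0) (hK0.mono fun x hx => by simp [hx])] at hmass
  simp [hα, Real.pi_ne_zero] at hmass

end IsLogGrowthSolution

end Plane

section Compactness

variable {E : Type*} [NormedAddCommGroup E] [InnerProductSpace ℝ E] [FiniteDimensional ℝ E]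
  [MeasurableSpace E] [BorelSpace E] {f ψ : E → ℝ} {C : ℝ}

theorem lipschitzWith_convolution (hψ : ContDiff ℝ ∞ ψ) (hc : HasCompactSupport ψ)
    (hf : LocallyIntegrable f volume) (hC : ∀ x, |f x| ≤ C) :
    LipschitzWith (Real.toNNReal (C * ∫ z, ‖fderiv ℝ ψ z‖)) (ψ ⋆ f) := by
  have hC0 : 0 ≤ C := (abs_nonneg _).trans (hC 0)
  have hψ' : Integrable (fderiv ℝ ψ) :=
    (hψ.continuous_fderiv (by simp)).integrable_of_hasCompactSupport (hc.fderiv ℝ)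
  refine lipschitzWith_of_nnnorm_fderiv_le
    ((contDiff_convolution hψ hc hf).differentiable (by simp)) fun x => ?_
  rw [← NNReal.coe_le_coe, coe_nnnorm, Real.coe_toNNReal _ (by positivity)]
  refine ContinuousLinearMap.opNorm_le_bound _ (by positivity) fun v => ?_
  rw [fderiv_convolution_apply hψ hc hf, Real.norm_eq_abs, mul_assoc, ← integral_mul_const]
  refine (abs_convolution_le (hψ'.apply_continuousLinearMap v) fun y _ => hC y).trans ?_
  refine mul_le_mul_of_nonneg_left (integral_mono (hψ'.apply_continuousLinearMap v).abs
    (hψ'.norm.mul_const _) fun z => ?_) hC0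
  exact (fderiv ℝ ψ z).le_opNorm v

theorem HasWeakLaplacian.of_tendsto {Y F : ℕ → E → ℝ} {y : E → ℝ}
    (h : ∀ n, HasWeakLaplacian (Y n) (F n)) (hC : ∀ n x, |Y n x| ≤ C)
    (hF : ∀ R : ℝ, ∃ M, ∀ n x, ‖x‖ ≤ R → |F n x| ≤ M) (hy : LocallyIntegrable y volume)
    (hf : LocallyIntegrable f volume) (hlimY : ∀ x, Tendsto (fun n => Y n x) atTop (𝓝 (y x)))
    (hlimF : ∀ x, Tendsto (fun n => F n x) atTop (𝓝 (f x))) : HasWeakLaplacian y f := by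
  refine ⟨hy, hf, fun φ hφ hc => ?_⟩
  have limY : Tendsto (fun n => ∫ x, Y n x * Δ φ x) atTop (𝓝 (∫ x, y x * Δ φ x)) :=
    tendsto_integral_mul_of_ae_tendsto (contDiff_laplacian hφ).continuous
      (hasCompactSupport_laplacian hc) (fun n => (h n).1.aestronglyMeasurable)
      (fun n x _ => hC n x) (.of_forall hlimY)
  have limF : Tendsto (fun n => ∫ x, F n x * φ x) atTop (𝓝 (∫ x, f x * φ x)) := by
    obtain ⟨R, hR⟩ := hc.isCompact.isBounded.subset_closedBall (0 : E)
    obtain ⟨M, hM⟩ := hF R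
    exact tendsto_integral_mul_of_ae_tendsto hφ.continuous hc
      (fun n => (h n).2.aestronglyMeasurable)
      (fun n x hx => hM n x (mem_closedBall_zero_iff.1 (hR (subset_tsupport _ hx))))
      (.of_forall hlimF)
  exact tendsto_nhds_unique limY (limF.congr fun n => ((h n).3 φ hφ hc).symm)

theorem equicontinuous_of_forall_exists_dist_le {ι X : Type*} [TopologicalSpace X]
    {Y : ι → X → ℝ}
    (h : ∀ x, ∀ ε > 0, ∃ Z : ι → X → ℝ, Equicontinuous Z ∧
      ∀ᶠ y in 𝓝 x, ∀ i, dist (Z i y) (Y i y) ≤ ε) : Equicontinuous Y := by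
  refine fun x => Metric.equicontinuousAt_iff_right.2 fun ε hε => ?_
  obtain ⟨Z, hZ, hZY⟩ := h x (ε / 4) (by positivity)
  filter_upwards [Metric.equicontinuousAt_iff_right.1 (hZ x) (ε / 4) (by positivity), hZY]
    with y hy hy' i
  have hx := hZY.self_of_nhds i
  calc dist (Y i x) (Y i y)
      ≤ dist (Y i x) (Z i x) + dist (Z i x) (Z i y) + dist (Z i y) (Y i y) := dist_triangle4 ..
    _ < ε := by
      rw [dist_comm (Y i x)]
      linarith [hy i, hy' i]

theorem exists_tendsto_subseq_of_equicontinuous {X : Type*} [TopologicalSpace X]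
    [TopologicalSpace.SeparableSpace X] [Nonempty X] {Y : ℕ → X → ℝ} {c : ℝ}
    (hY : Equicontinuous Y) (hc : ∀ n x, |Y n x| ≤ c) :
    ∃ (y : X → ℝ) (θ : ℕ → ℕ), StrictMono θ ∧ Continuous y ∧
      ∀ x, Tendsto (fun n => Y (θ n) x) atTop (𝓝 (y x)) := by
  have hK : IsCompact (Set.pi Set.univ fun _ : ℕ => Set.Icc (-c) c) :=
    isCompact_univ_pi fun _ => isCompact_Icc
  obtain ⟨a, -, θ, hθ, ha⟩ := hK.tendsto_subseq
    (x := fun n j => Y n (TopologicalSpace.denseSeq X j)) fun n j _ => abs_le.1 (hc n _)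
  have hcauchy (x : X) : CauchySeq fun n => Y (θ n) x := by
    refine Metric.cauchySeq_iff'.2 fun ε hε => ?_
    have hnear := Metric.equicontinuousAt_iff_right.1 (hY x) (ε / 3) (by positivity)
    obtain ⟨z, hz, j, rfl⟩ := (mem_closure_iff_nhds.1
      ((TopologicalSpace.denseRange_denseSeq X) x)) _ hnear
    obtain ⟨N, hN⟩ := Metric.cauchySeq_iff'.1 ((tendsto_pi_nhds.1 ha j).cauchySeq) (ε / 3)
      (by positivity)
    refine ⟨N, fun n hn => ?_⟩
    have hxn := hz (θ n)
    have hxN := hz (θ N)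
    have hnN := hN n hn
    simp only [Function.comp, Real.dist_eq, abs_lt] at hxn hxN hnN ⊢
    constructor <;> linarith
  choose y hy using fun x => cauchySeq_tendsto_of_complete (hcauchy x)
  exact ⟨y, θ, hθ, (tendsto_pi_nhds.2 hy).continuous_of_equicontinuous (hY.comp θ), hy⟩

end Compactness

section LogarithmicPotential

section EqLog

variable {w : Plane → ℝ} {r : ℝ}

theorem laplacian_eq_zero_of_eq_log (hr : 0 ≤ r) (hlog : ∀ x, r ≤ ‖x‖ → w x = Real.log ‖x‖)
    {x : Plane} (hx : r < ‖x‖) : Δ w x = 0 := by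
  have hx0 : x ≠ 0 := norm_pos_iff.1 (hr.trans_lt hx)
  have hw : w =ᶠ[𝓝 x] fun y => id (Real.log ‖y‖) :=
    (continuousAt_const.eventually_lt continuous_norm.continuousAt hx).mono
      fun y hy => hlog y hy.le
  rw [(InnerProductSpace.laplacian_congr_nhds hw).eq_of_nhds,
    laplacian_comp_log_norm hx0 contDiff_id.contDiffAt]
  simp

theorem hasCompactSupport_laplacian_of_eq_log (hr : 0 ≤ r)
    (hlog : ∀ x, r ≤ ‖x‖ → w x = Real.log ‖x‖) : HasCompactSupport (Δ w) :=
  .intro (isCompact_closedBall 0 r) fun _ hx =>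
    laplacian_eq_zero_of_eq_log hr hlog (by simpa using hx)

theorem integral_laplacian_of_eq_log (hw : ContDiff ℝ ∞ w) (hr : 0 ≤ r)
    (hlog : ∀ x, r ≤ ‖x‖ → w x = Real.log ‖x‖) : ∫ x, Δ w x = 2 * Real.pi := by
  have hi : Integrable (Δ w) := (contDiff_laplacian hw).continuous.integrable_of_hasCompactSupport
    (hasCompactSupport_laplacian_of_eq_log hr hlog)
  simpa using (hasWeakLaplacian_of_contDiff hw).integral_eq_of_log_growth (α := 1) (R := r) (C := 0)
    hi fun x hx => by simp [hlog x hx.le]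

end EqLog

/-- The dilates `w_k(x) = w(2ᵏx) - k log 2`. If `w` is `log ‖x‖` off the unit ball, then `w_k` is
`log ‖x‖` off the ball of radius `2⁻ᵏ`, so these are smooth approximations of the logarithm. -/
noncomputable def regularizedLog (w : Plane → ℝ) (k : ℕ) (x : Plane) : ℝ :=
  w ((2 : ℝ) ^ k • x) - k * Real.log 2

/-- The approximate identity `(2π)⁻¹ Δ w_k`. -/
noncomputable def logKernel (w : Plane → ℝ) (k : ℕ) (x : Plane) : ℝ :=
  (2 * Real.pi)⁻¹ * Δ (regularizedLog w k) x

/-- The potential `(2π)⁻¹ (w_k - w_{k+1})` of the difference of two consecutive kernels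
`logKernel w k`. -/
noncomputable def logIncrement (w : Plane → ℝ) (k : ℕ) (x : Plane) : ℝ :=
  (2 * Real.pi)⁻¹ * (regularizedLog w k x - regularizedLog w (k + 1) x)

variable {w : Plane → ℝ}

theorem inv_two_pow_le_one (k : ℕ) : ((2 : ℝ) ^ k)⁻¹ ≤ 1 :=
  inv_le_one_of_one_le₀ (one_le_pow₀ one_le_two)

theorem contDiff_regularizedLog (hw : ContDiff ℝ ∞ w) (k : ℕ) :
    ContDiff ℝ ∞ (regularizedLog w k) := by
  unfold regularizedLog
  fun_prop

theorem contDiff_logKernel (hw : ContDiff ℝ ∞ w) (k : ℕ) : ContDiff ℝ ∞ (logKernel w k) :=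
  contDiff_const.mul (contDiff_laplacian (contDiff_regularizedLog hw k))

theorem contDiff_logIncrement (hw : ContDiff ℝ ∞ w) (k : ℕ) : ContDiff ℝ ∞ (logIncrement w k) :=
  contDiff_const.mul ((contDiff_regularizedLog hw k).sub (contDiff_regularizedLog hw (k + 1)))

theorem laplacian_regularizedLog (hw : ContDiff ℝ ∞ w) (k : ℕ) (x : Plane) :
    Δ (regularizedLog w k) x = 4 ^ k * Δ w ((2 : ℝ) ^ k • x) := by
  have hd : ContDiff ℝ ∞ fun y : Plane => w (0 + (2 : ℝ) ^ k • y) := by fun_prop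
  have h := ((hd.of_le (by norm_cast)).contDiffAt (x := x)).laplacian_sub
    (contDiffAt_const (c := k * Real.log 2))
  rw [laplacian_eq_zero_of_eventuallyEq_const (c := k * Real.log 2) .rfl,
    laplacian_comp_const_add_smul hw, sub_zero] at h
  convert h using 2
  · ext y
    simp [regularizedLog]
  · rw [← pow_mul, mul_comm, pow_mul]
    norm_num
  · simp

theorem laplacian_logIncrement (hw : ContDiff ℝ ∞ w) (k : ℕ) :
    Δ (logIncrement w k) = logKernel w k - logKernel w (k + 1) := by
  have hk (j : ℕ) (x : Plane) : ContDiffAt ℝ 2 (regularizedLog w j) x :=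
    ((contDiff_regularizedLog hw j).of_le (by norm_cast)).contDiffAt
  ext x
  rw [Pi.sub_apply, logKernel, logKernel, ← mul_sub]
  exact (InnerProductSpace.laplacian_smul (2 * Real.pi)⁻¹ ((hk k x).sub (hk (k + 1) x))).trans
    (congrArg _ ((hk k x).laplacian_sub (hk (k + 1) x)))

theorem integral_abs_logIncrement (k : ℕ) :
    ∫ x, |logIncrement w k x| = (∫ x, |logIncrement w 0 x|) * (1 / 4) ^ k := by
  have hscale (x : Plane) : logIncrement w k x = logIncrement w 0 ((2 : ℝ) ^ k • x) := by
    simp only [logIncrement, regularizedLog, smul_smul, ← pow_add]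
    rw [add_comm k 1]
    push_cast
    ring_nf
  simp only [hscale, Measure.integral_comp_smul volume (fun x => |logIncrement w 0 x|),
    finrank_euclideanSpace_fin, smul_eq_mul]
  rw [abs_of_pos (by positivity), mul_comm, ← pow_mul, mul_comm k, pow_mul, ← inv_pow]
  norm_num

variable (hlog : ∀ x, 1 ≤ ‖x‖ → w x = Real.log ‖x‖)

include hlog

theorem regularizedLog_eq_log (k : ℕ) (x : Plane) (hx : ((2 : ℝ) ^ k)⁻¹ ≤ ‖x‖) :
    regularizedLog w k x = Real.log ‖x‖ := by
  have hk : (0 : ℝ) < 2 ^ k := by positivity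
  have hx0 : ‖x‖ ≠ 0 := ((inv_pos.2 hk).trans_le hx).ne'
  have hnorm : ‖(2 : ℝ) ^ k • x‖ = 2 ^ k * ‖x‖ := by rw [norm_smul, Real.norm_of_nonneg hk.le]
  rw [regularizedLog, hlog _ (hnorm ▸ (inv_le_iff_one_le_mul₀' hk).1 hx), hnorm,
    Real.log_mul hk.ne' hx0, Real.log_pow, add_sub_cancel_left]

theorem logKernel_eq_zero {k : ℕ} {x : Plane} (hx : ((2 : ℝ) ^ k)⁻¹ < ‖x‖) :
    logKernel w k x = 0 := by
  rw [logKernel, laplacian_eq_zero_of_eq_log (by positivity) (regularizedLog_eq_log hlog k) hx,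
    mul_zero]

theorem logIncrement_eq_zero {k : ℕ} {x : Plane} (hx : 1 < ‖x‖) : logIncrement w k x = 0 := by
  have h (j : ℕ) := regularizedLog_eq_log hlog j x ((inv_two_pow_le_one j).trans hx.le)
  rw [logIncrement, h, h, sub_self, mul_zero]

theorem hasCompactSupport_logKernel (k : ℕ) : HasCompactSupport (logKernel w k) :=
  .intro (isCompact_closedBall 0 ((2 : ℝ) ^ k)⁻¹) fun _ hx =>
    logKernel_eq_zero hlog (by simpa using hx)

theorem hasCompactSupport_logIncrement (k : ℕ) : HasCompactSupport (logIncrement w k) :=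
  .intro (isCompact_closedBall 0 1) fun _ hx => logIncrement_eq_zero hlog (by simpa using hx)

theorem ae_tendsto_convolution_logKernel (hw : ContDiff ℝ ∞ w) {u : Plane → ℝ}
    (hu : LocallyIntegrable u volume) :
    ∀ᵐ x, Tendsto (fun k => (logKernel w k ⋆ u) x) atTop (𝓝 (u x)) := by
  obtain ⟨M, hM⟩ := (hasCompactSupport_laplacian_of_eq_log zero_le_one
    hlog).exists_bound_of_continuous (contDiff_laplacian hw).continuous
  filter_upwards [(Besicovitch.vitaliFamily volume).ae_tendsto_average_norm_sub hu] with x hx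
  have hr : Tendsto (fun k : ℕ => ((2 : ℝ) ^ k)⁻¹) atTop (𝓝[>] 0) :=
    tendsto_inv_atTop_nhdsGT_zero.comp (tendsto_pow_atTop_atTop_of_one_lt one_lt_two)
  simp only [convolution_lsmul_swap]
  refine tendsto_integral_smul_of_tendsto_average_norm_sub
    (g := fun k y => logKernel w k (x - y)) (M / 2)
    ((hx.comp (Besicovitch.tendsto_filterAt volume x)).comp hr)
    (.of_forall fun k => hu.integrableOn_isCompact (isCompact_closedBall _ _))
    (tendsto_const_nhds.congr fun k => ?_) (.of_forall fun k y hy => ?_)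
    (.of_forall fun k y => ?_)
  · rw [integral_sub_left_eq_self (logKernel w k) volume x]
    simp only [logKernel, integral_const_mul, integral_laplacian_of_eq_log
      (contDiff_regularizedLog hw k) (by positivity) (regularizedLog_eq_log hlog k)]
    field_simp
  · by_contra hxy
    exact hy (logKernel_eq_zero hlog (by simpa [dist_eq_norm, norm_sub_rev] using hxy))
  · have hvol : volume.real (Metric.closedBall x ((2 : ℝ) ^ k)⁻¹) = Real.pi / 4 ^ k := by
      rw [measureReal_def, EuclideanSpace.volume_closedBall_fin_two, ← inv_pow]
      simp only [inv_pow, Nat.ofNat_pos, pow_pos, ENNReal.ofReal_inv_of_pos, Nat.ofNat_nonneg,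
        ENNReal.ofReal_pow, ENNReal.ofReal_ofNat, ENNReal.toReal_mul, ENNReal.toReal_pow,
        ENNReal.toReal_inv, ENNReal.toReal_ofNat, ← pow_mul, mul_comm k, Real.pi_pos.le,
        ENNReal.toReal_ofReal, div_eq_inv_mul, mul_eq_mul_right_iff, inv_inj, Real.pi_ne_zero,
        or_false]
      norm_num [pow_mul]
    rw [hvol, logKernel, laplacian_regularizedLog hw, abs_mul, abs_mul,
      abs_of_pos (by positivity : (0 : ℝ) < (2 * Real.pi)⁻¹),
      abs_of_pos (by positivity : (0 : ℝ) < 4 ^ k)]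
    calc (2 * Real.pi)⁻¹ * (4 ^ k * |Δ w ((2 : ℝ) ^ k • (x - y))|)
        ≤ (2 * Real.pi)⁻¹ * (4 ^ k * M) := by gcongr; exact hM _
      _ = M / 2 / (Real.pi / 4 ^ k) := by field_simp

end LogarithmicPotential

section ContinuousRepresentative

variable {w : Plane → ℝ} (hw : ContDiff ℝ ∞ w) (hlog : ∀ x, 1 ≤ ‖x‖ → w x = Real.log ‖x‖)

include hw hlog

theorem dist_convolution_logKernel_succ_le {u f : Plane → ℝ} (h : HasWeakLaplacian u f) {M : ℝ}
    {x : Plane} (hM : ∀ y, ‖x - y‖ ≤ 1 → |f y| ≤ M) (k : ℕ) :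
    dist ((logKernel w k ⋆ u) x) ((logKernel w (k + 1) ⋆ u) x) ≤
      M * (∫ z, |logIncrement w 0 z|) * (1 / 4) ^ k := by
  have hκ (j : ℕ) := (hasCompactSupport_logKernel hlog j).convolutionExists_left
    (ContinuousLinearMap.lsmul ℝ ℝ) (contDiff_logKernel hw j).continuous h.1 x
  have hsmooth := contDiff_logIncrement hw k
  have hcomp := hasCompactSupport_logIncrement hlog k
  rw [Real.dist_eq, ← sub_convolution_apply (hκ k) (hκ (k + 1)), ← laplacian_logIncrement hw,
    h.laplacian_convolution_eq hsmooth hcomp, mul_assoc, ← integral_abs_logIncrement k]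
  exact abs_convolution_le (hsmooth.continuous.integrable_of_hasCompactSupport hcomp)
    fun y hy => hM y (not_lt.1 fun hxy => hy (logIncrement_eq_zero hlog hxy))

theorem eventually_dist_convolution_logKernel_le {ι : Type*} {U F U' : ι → Plane → ℝ}
    (h : ∀ i, HasWeakLaplacian (U i) (F i))
    (hF : ∀ R : ℝ, ∃ M, ∀ i x, ‖x‖ ≤ R → |F i x| ≤ M)
    (hlim : ∀ i x, Tendsto (fun k => (logKernel w k ⋆ U i) x) atTop (𝓝 (U' i x)))
    (x : Plane) {ε : ℝ} (hε : 0 < ε) :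
    ∃ k, ∀ᶠ y in 𝓝 x, ∀ i, dist ((logKernel w k ⋆ U i) y) (U' i y) ≤ ε := by
  obtain ⟨M, hM⟩ := hF (‖x‖ + 2)
  have hgeom : Tendsto (fun k : ℕ => M * (∫ z, |logIncrement w 0 z|) * (1 / 4) ^ k / (1 - 1 / 4))
      atTop (𝓝 0) := by
    simpa using ((tendsto_pow_atTop_nhds_zero_of_lt_one (r := (1 / 4 : ℝ)) (by norm_num)
      (by norm_num)).const_mul (M * ∫ z, |logIncrement w 0 z|)).div_const (1 - 1 / 4)
  obtain ⟨k, hk⟩ := (hgeom.eventually_le_const hε).exists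
  refine ⟨k, Filter.mem_of_superset (Metric.ball_mem_nhds x one_pos) fun y hy i => ?_⟩
  refine (dist_le_of_le_geometric_of_tendsto _ _ (by norm_num)
    (dist_convolution_logKernel_succ_le hw hlog (h i) fun z hz => hM i z ?_) (hlim i y) k).trans hk
  have hyx : ‖y - x‖ < 1 := by simpa [dist_eq_norm] using hy
  have h₁ := norm_sub_norm_le y x
  have h₂ := norm_sub_norm_le z y
  rw [norm_sub_rev] at h₂
  linarith

theorem exists_continuous_representative {u f : Plane → ℝ} (h : HasWeakLaplacian u f)
    (hf : IsLocallyBounded f) : ∃ u' : Plane → ℝ, Continuous u' ∧ u =ᵐ[volume] u' ∧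
      ∀ x, Tendsto (fun k => (logKernel w k ⋆ u) x) atTop (𝓝 (u' x)) := by
  have hcauchy (x : Plane) : CauchySeq fun k => (logKernel w k ⋆ u) x := by
    obtain ⟨M, hM⟩ := hf (‖x‖ + 1)
    refine cauchySeq_of_le_geometric _ _ (by norm_num)
      (dist_convolution_logKernel_succ_le hw hlog h fun y hy => hM y ?_)
    rw [norm_sub_rev] at hy
    linarith [norm_sub_norm_le y x]
  choose u' hu' using fun x => cauchySeq_tendsto_of_complete (hcauchy x)
  refine ⟨u', ?_, ?_, hu'⟩
  · refine (equicontinuous_unique (ι := Unit) (F := fun _ => u')).1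
      (equicontinuous_of_forall_exists_dist_le fun x ε hε => ?_)
    obtain ⟨k, hk⟩ := eventually_dist_convolution_logKernel_le (ι := Unit) hw hlog (fun _ => h)
      (fun R => (hf R).imp fun M hM _ => hM) (fun _ => hu') x hε
    exact ⟨fun _ => logKernel w k ⋆ u, equicontinuous_unique.2 (contDiff_convolution
      (contDiff_logKernel hw k) (hasCompactSupport_logKernel hlog k) h.1).continuous, hk⟩
  · filter_upwards [ae_tendsto_convolution_logKernel hlog hw h.1] with x hx
    exact tendsto_nhds_unique hx (hu' x)

theorem tendsto_convolution_logKernel {u f : Plane → ℝ} (h : HasWeakLaplacian u f)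
    (hf : IsLocallyBounded f) (hu : Continuous u) (x : Plane) :
    Tendsto (fun k => (logKernel w k ⋆ u) x) atTop (𝓝 (u x)) := by
  obtain ⟨u', hu', hae, hlim⟩ := exists_continuous_representative hw hlog h hf
  rw [congr_fun ((hu.ae_eq_iff_eq volume hu').1 hae) x]
  exact hlim x

theorem equicontinuous_of_hasWeakLaplacian {ι : Type*} {U F : ι → Plane → ℝ} {C : ℝ}
    (h : ∀ i, HasWeakLaplacian (U i) (F i)) (hU : ∀ i, Continuous (U i))
    (hC : ∀ i x, |U i x| ≤ C) (hF : ∀ R : ℝ, ∃ M, ∀ i x, ‖x‖ ≤ R → |F i x| ≤ M) :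
    Equicontinuous U := by
  refine equicontinuous_of_forall_exists_dist_le fun x ε hε => ?_
  obtain ⟨k, hk⟩ := eventually_dist_convolution_logKernel_le hw hlog h hF
    (fun i => tendsto_convolution_logKernel hw hlog (h i)
      (fun R => (hF R).imp fun M hM => hM i) (hU i)) x hε
  exact ⟨fun i => logKernel w k ⋆ U i, (LipschitzWith.uniformEquicontinuous _ _ fun i =>
    lipschitzWith_convolution (contDiff_logKernel hw k) (hasCompactSupport_logKernel hlog k)
      (h i).1 (hC i)).equicontinuous, hk⟩

end ContinuousRepresentative

section HeatKernel

variable {E : Type*} [NormedAddCommGroup E] [InnerProductSpace ℝ E]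

/-- The heat kernel `p_s(x) = (4πs)^{-d/2} e^{-‖x‖²/4s}`, for `s > 0`, where `d = dim E`. -/
noncomputable def heatKernel (s : ℝ) (x : E) : ℝ :=
  (4 * Real.pi * s) ^ (-(Module.finrank ℝ E / 2 : ℝ)) * Real.exp (-(‖x‖ ^ 2 / (4 * s)))

theorem heatKernel_nonneg {s : ℝ} (hs : 0 < s) (x : E) : 0 ≤ heatKernel s x := by
  unfold heatKernel
  positivity

theorem contDiff_heatKernel (s : ℝ) : ContDiff ℝ ∞ (heatKernel s : E → ℝ) :=
  contDiff_const.mul ((contDiff_norm_sq ℝ).div_const _).neg.exp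

theorem continuousOn_heatKernel :
    ContinuousOn (fun p : ℝ × E => heatKernel p.1 p.2) (Set.Ioi 0 ×ˢ Set.univ) := by
  have hs (p : ℝ × E) (hp : p ∈ Set.Ioi (0 : ℝ) ×ˢ (Set.univ : Set E)) : 0 < p.1 := hp.1
  unfold heatKernel
  refine ContinuousOn.mul ?_ ?_
  · exact ContinuousOn.rpow_const (by fun_prop) fun p hp =>
      .inl (mul_pos (by positivity) (hs p hp)).ne'
  · exact (ContinuousOn.div (by fun_prop) (by fun_prop) fun p hp =>
      (mul_pos four_pos (hs p hp)).ne').neg.rexp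

variable [FiniteDimensional ℝ E]

theorem laplacian_heatKernel (s : ℝ) (x : E) :
    Δ (heatKernel s : E → ℝ) x =
      heatKernel s x * (‖x‖ ^ 2 / (4 * s ^ 2) - Module.finrank ℝ E / (2 * s)) := by
  set a : ℝ := (4 * Real.pi * s) ^ (-(Module.finrank ℝ E / 2 : ℝ))
  let β (r : ℝ) : ℝ := a * Real.exp (-(r / (4 * s)))
  have hd (r : ℝ) : HasDerivAt β (-(4 * s)⁻¹ * β r) r := by
    refine ((((hasDerivAt_id r).div_const (4 * s)).fun_neg.exp).const_mul a).congr_deriv ?_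
    simp only [β, id]
    ring
  have hd₁ : deriv β = fun r => -(4 * s)⁻¹ * β r := funext fun r => (hd r).deriv
  have hd₂ : deriv (deriv β) (‖x‖ ^ 2) = -(4 * s)⁻¹ * (-(4 * s)⁻¹ * β (‖x‖ ^ 2)) := by
    rw [hd₁]
    exact ((hd _).const_mul _).deriv
  have hβ : ContDiff ℝ 2 β := by fun_prop
  change Δ (fun y : E => β (‖y‖ ^ 2)) x = β (‖x‖ ^ 2) * _
  rw [laplacian_comp_norm_sq hβ.contDiffAt, hd₂, hd₁]
  ring

theorem hasDerivAt_heatKernel {s : ℝ} (hs : 0 < s) (x : E) :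
    HasDerivAt (fun r => heatKernel r x) (Δ (heatKernel s : E → ℝ) x) s := by
  have hpow : HasDerivAt (fun r : ℝ => (4 * Real.pi * r) ^ (-(Module.finrank ℝ E / 2 : ℝ))) _ s :=
    ((hasDerivAt_id s).const_mul (4 * Real.pi)).rpow_const (.inl (by simp only [id]; positivity))
  have hexp : HasDerivAt (fun r : ℝ => Real.exp (-(‖x‖ ^ 2 / (4 * r)))) _ s :=
    ((hasDerivAt_const s (‖x‖ ^ 2)).fun_div ((hasDerivAt_id s).const_mul 4)
      (by simp only [id]; positivity)).fun_neg.exp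
  refine (hpow.mul hexp).congr_deriv ?_
  rw [laplacian_heatKernel, heatKernel, id, Real.rpow_sub_one (by positivity)]
  field_simp
  ring

theorem continuousOn_laplacian_heatKernel :
    ContinuousOn (fun p : ℝ × E => Δ (heatKernel p.1 : E → ℝ) p.2) (Set.Ioi 0 ×ˢ Set.univ) := by
  have hs (p : ℝ × E) (hp : p ∈ Set.Ioi (0 : ℝ) ×ˢ (Set.univ : Set E)) : p.1 ≠ 0 := hp.1.ne'
  simp only [laplacian_heatKernel]
  refine continuousOn_heatKernel.mul (.sub ?_ ?_)
  · exact .div (by fun_prop) (by fun_prop) fun p hp => by simp [hs p hp]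
  · exact .div (by fun_prop) (by fun_prop) fun p hp => by simp [hs p hp]

variable [MeasurableSpace E] [BorelSpace E]

theorem integral_heatKernel {s : ℝ} (hs : 0 < s) : ∫ x : E, heatKernel s x = 1 := by
  have hgauss := GaussianFourier.integral_rexp_neg_mul_sq_norm (V := E) (b := (4 * s)⁻¹)
    (by positivity)
  have hexp (x : E) : -(‖x‖ ^ 2 / (4 * s)) = -(4 * s)⁻¹ * ‖x‖ ^ 2 := by ring
  simp only [heatKernel, hexp, integral_const_mul, hgauss]
  rw [div_inv_eq_mul, show Real.pi * (4 * s) = 4 * Real.pi * s by ring,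
    ← Real.rpow_add (by positivity), neg_add_cancel, Real.rpow_zero]

theorem integrable_heatKernel {s : ℝ} (hs : 0 < s) : Integrable (heatKernel s : E → ℝ) :=
  integrable_of_integral_eq_one (integral_heatKernel hs)

/-- The heat semigroup `e^{sΔ} φ`, evaluated at the origin. -/
noncomputable def heatAverage (φ : E → ℝ) (s : ℝ) : ℝ := ∫ y, heatKernel s y * φ y

variable {φ : E → ℝ}

theorem hasDerivAt_heatAverage (hφ : ContDiff ℝ ∞ φ) (hc : HasCompactSupport φ) {s : ℝ}
    (hs : 0 < s) : HasDerivAt (heatAverage φ) (heatAverage (Δ φ) s) s := by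
  obtain ⟨M, hM⟩ := ((isCompact_Icc (a := s / 2) (b := 2 * s)).prod hc.isCompact
    ).exists_bound_of_continuousOn (continuousOn_laplacian_heatKernel.mono (Set.prod_mono
      (fun r hr => (half_pos hs).trans_le hr.1) (Set.subset_univ _)))
  have hkernel (r : ℝ) : Integrable fun y => heatKernel r y * φ y :=
    ((contDiff_heatKernel r).continuous.mul hφ.continuous).integrable_of_hasCompactSupport
      hc.mul_left
  rw [heatAverage, integral_mul_laplacian (contDiff_heatKernel s) hφ hc]
  refine (hasDerivAt_integral_of_dominated_loc_of_deriv_le (bound := fun y => M * |φ y|)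
    (F' := fun r y => Δ (heatKernel r : E → ℝ) y * φ y)
    (Icc_mem_nhds (by linarith : s / 2 < s) (by linarith : s < 2 * s))
    (.of_forall fun r => (hkernel r).aestronglyMeasurable) (hkernel s)
    ((contDiff_laplacian (contDiff_heatKernel s)).continuous.mul
      hφ.continuous).aestronglyMeasurable
    (.of_forall fun y r hr => ?_)
    ((hφ.continuous.integrable_of_hasCompactSupport hc).abs.const_mul M)
    (.of_forall fun y r hr => ?_)).2
  · rw [norm_mul]
    by_cases hy : φ y = 0
    · simp [hy]
    · exact mul_le_mul_of_nonneg_right (hM (r, y) ⟨hr, subset_tsupport φ hy⟩) (norm_nonneg _)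
  · exact (hasDerivAt_heatKernel ((half_pos hs).trans_le hr.1) y).mul_const _

theorem abs_heatAverage_le {C : ℝ} (hC : ∀ x, |φ x| ≤ C) {s : ℝ} (hs : 0 < s) :
    |heatAverage φ s| ≤ C := by
  have htotal : ∫ y : E, heatKernel s y * C = C := by
    rw [integral_mul_const, integral_heatKernel hs, one_mul]
  rw [← htotal]
  refine norm_integral_le_of_norm_le (f := fun y => heatKernel s y * φ y)
    ((integrable_heatKernel hs).mul_const C) (.of_forall fun y => ?_)
  rw [norm_mul, Real.norm_of_nonneg (heatKernel_nonneg hs y)]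
  exact mul_le_mul_of_nonneg_left (hC y) (heatKernel_nonneg hs y)

theorem heatAverage_eq_integral_comp_smul (φ : E → ℝ) {s : ℝ} (hs : 0 < s) :
    heatAverage φ s = ∫ z, heatKernel 1 z * φ (√s • z) := by
  have hscale (z : E) : heatKernel s (√s • z) =
      s ^ (-(Module.finrank ℝ E / 2 : ℝ)) * heatKernel 1 z := by
    simp only [heatKernel, norm_smul, mul_pow, Real.norm_eq_abs, sq_abs, Real.sq_sqrt hs.le,
      mul_one, Real.mul_rpow (by positivity : 0 ≤ 4 * Real.pi) hs.le]
    rw [mul_comm 4 s, mul_div_mul_left _ _ hs.ne']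
    ring
  have hpow : |((√s) ^ Module.finrank ℝ E)⁻¹| = s ^ (-(Module.finrank ℝ E / 2 : ℝ)) := by
    rw [abs_of_nonneg (by positivity), Real.sqrt_eq_rpow, ← Real.rpow_mul_natCast hs.le,
      Real.rpow_neg hs.le]
    ring_nf
  have hsubst := Measure.integral_comp_smul volume (fun y => heatKernel s y * φ y) √s
  simp only [hscale, mul_assoc, integral_const_mul, hpow, smul_eq_mul] at hsubst
  exact (mul_left_cancel₀ (Real.rpow_pos_of_pos hs _).ne' hsubst).symm

theorem tendsto_heatAverage_zero (hφ : Continuous φ) {C : ℝ} (hC : ∀ x, |φ x| ≤ C) :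
    Tendsto (heatAverage φ) (𝓝[>] 0) (𝓝 (φ 0)) := by
  have hlim : Tendsto (fun s => ∫ z, heatKernel 1 z * φ (√s • z)) (𝓝[>] 0)
      (𝓝 (∫ z : E, heatKernel 1 z * φ 0)) := by
    refine tendsto_integral_filter_of_dominated_convergence (fun z => heatKernel 1 z * C)
      (.of_forall fun s => ((contDiff_heatKernel 1).continuous.mul
        (hφ.comp (continuous_const_smul _))).aestronglyMeasurable)
      (.of_forall fun s => .of_forall fun z => ?_)
      ((integrable_heatKernel one_pos).mul_const C) (.of_forall fun z => .const_mul _ ?_)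
    · rw [norm_mul, Real.norm_of_nonneg (heatKernel_nonneg one_pos z)]
      exact mul_le_mul_of_nonneg_left (hC _) (heatKernel_nonneg one_pos z)
    · have hcont : Continuous fun s : ℝ => φ (√s • z) := by fun_prop
      simpa using (hcont.tendsto 0).mono_left (nhdsWithin_le_nhds (s := Set.Ioi 0))
  rw [integral_mul_const, integral_heatKernel one_pos, one_mul] at hlim
  refine hlim.congr' ?_
  filter_upwards [self_mem_nhdsWithin] with s hs
  exact (heatAverage_eq_integral_comp_smul φ hs).symm

end HeatKernel

section Resolvent

variable {E : Type*} [NormedAddCommGroup E] [InnerProductSpace ℝ E]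

/-- The integral kernel of `(μ - Δ)⁻¹`, as the Laplace transform of the heat kernel. -/
noncomputable def resolventKernel (μ : ℝ) (y : E) : ℝ :=
  ∫ s in Set.Ioi (0 : ℝ), Real.exp (-μ * s) * heatKernel s y

theorem resolventKernel_nonneg (μ : ℝ) (y : E) : 0 ≤ resolventKernel μ y :=
  setIntegral_nonneg measurableSet_Ioi fun _ hs =>
    mul_nonneg (Real.exp_pos _).le (heatKernel_nonneg hs y)

variable [FiniteDimensional ℝ E] [MeasurableSpace E] [BorelSpace E] {μ : ℝ}

theorem integrable_exp_mul_heatKernel (hμ : 0 < μ) :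
    Integrable (fun p : ℝ × E => Real.exp (-μ * p.1) * heatKernel p.1 p.2)
      ((volume.restrict (Set.Ioi 0)).prod volume) := by
  have hm : Measurable fun p : ℝ × E => Real.exp (-μ * p.1) * heatKernel p.1 p.2 := by
    unfold heatKernel
    fun_prop
  refine (integrable_prod_iff hm.aestronglyMeasurable).2 ⟨?_, ?_⟩
  · filter_upwards [ae_restrict_mem measurableSet_Ioi] with s hs
    exact (integrable_heatKernel hs).const_mul _
  · refine IntegrableOn.congr_fun (exp_neg_integrableOn_Ioi 0 hμ) (fun s hs => ?_)
      measurableSet_Ioi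
    simp only [norm_mul, Real.norm_of_nonneg (Real.exp_pos _).le,
      Real.norm_of_nonneg (heatKernel_nonneg hs _), integral_const_mul, integral_heatKernel hs,
      mul_one]

theorem integrable_resolventKernel (hμ : 0 < μ) : Integrable (resolventKernel μ : E → ℝ) :=
  (integrable_exp_mul_heatKernel hμ).integral_prod_right

theorem integral_abs_resolventKernel (hμ : 0 < μ) :
    ∫ y : E, |resolventKernel μ y| = μ⁻¹ := by
  calc ∫ y : E, |resolventKernel μ y| = ∫ y : E, resolventKernel μ y :=
        integral_congr_ae (.of_forall fun y => abs_of_nonneg (resolventKernel_nonneg μ y))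
    _ = ∫ s in Set.Ioi (0 : ℝ), ∫ y : E, Real.exp (-μ * s) * heatKernel s y :=
        (integral_integral_swap (integrable_exp_mul_heatKernel hμ)).symm
    _ = ∫ s in Set.Ioi (0 : ℝ), Real.exp (-μ * s) :=
        setIntegral_congr_fun measurableSet_Ioi fun s hs => by
          simp only [integral_const_mul, integral_heatKernel hs, mul_one]
    _ = μ⁻¹ := by
        rw [integral_exp_mul_Ioi (neg_lt_zero.2 hμ)]
        simp

theorem integrable_exp_mul_heatKernel_mul (hμ : 0 < μ) {ψ : E → ℝ} (hψ : Continuous ψ) {C : ℝ}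
    (hC : ∀ x, |ψ x| ≤ C) :
    Integrable (fun p : ℝ × E => Real.exp (-μ * p.1) * heatKernel p.1 p.2 * ψ p.2)
      ((volume.restrict (Set.Ioi 0)).prod volume) :=
  (integrable_exp_mul_heatKernel hμ).mul_bdd (c := C)
    (hψ.comp continuous_snd).aestronglyMeasurable (.of_forall fun p => hC p.2)

theorem integrableOn_exp_mul_heatAverage (hμ : 0 < μ) {ψ : E → ℝ} (hψ : Continuous ψ) {C : ℝ}
    (hC : ∀ x, |ψ x| ≤ C) :
    IntegrableOn (fun s => Real.exp (-μ * s) * heatAverage ψ s) (Set.Ioi 0) := by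
  simpa only [mul_assoc, integral_const_mul, heatAverage, IntegrableOn] using
    (integrable_exp_mul_heatKernel_mul hμ hψ hC).integral_prod_left

theorem integral_resolventKernel_mul (hμ : 0 < μ) {ψ : E → ℝ} (hψ : Continuous ψ) {C : ℝ}
    (hC : ∀ x, |ψ x| ≤ C) :
    ∫ y, resolventKernel μ y * ψ y =
      ∫ s in Set.Ioi (0 : ℝ), Real.exp (-μ * s) * heatAverage ψ s := by
  simp only [resolventKernel, heatAverage, ← integral_mul_const, ← integral_const_mul, ← mul_assoc]
  exact (integral_integral_swap (integrable_exp_mul_heatKernel_mul hμ hψ hC)).symm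

theorem integral_exp_mul_heatAverage_sub (hμ : 0 < μ) {φ : E → ℝ} (hφ : ContDiff ℝ ∞ φ)
    (hc : HasCompactSupport φ) :
    ∫ s in Set.Ioi (0 : ℝ), (μ * (Real.exp (-μ * s) * heatAverage φ s) -
      Real.exp (-μ * s) * heatAverage (Δ φ) s) = φ 0 := by
  have hΔ := (contDiff_laplacian hφ).continuous
  obtain ⟨C, hC⟩ := hc.exists_bound_of_continuous hφ.continuous
  obtain ⟨C', hC'⟩ := (hasCompactSupport_laplacian hc).exists_bound_of_continuous hΔ
  have hint := ((integrableOn_exp_mul_heatAverage hμ hφ.continuous hC).const_mul μ).sub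
    (integrableOn_exp_mul_heatAverage hμ hΔ hC')
  have hexp (s : ℝ) : HasDerivAt (fun s => -Real.exp (-μ * s)) (μ * Real.exp (-μ * s)) s := by
    simpa [mul_comm] using ((hasDerivAt_id s).const_mul (-μ)).exp.fun_neg
  have hstart : Tendsto (fun s => -Real.exp (-μ * s) * heatAverage φ s) (𝓝[>] 0) (𝓝 (-φ 0)) := by
    have hcont : Continuous fun s : ℝ => -Real.exp (-μ * s) := by fun_prop
    simpa using ((hcont.tendsto 0).mono_left nhdsWithin_le_nhds).mul
      (tendsto_heatAverage_zero hφ.continuous hC)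
  have hdecay : Tendsto (fun s => -Real.exp (-μ * s) * heatAverage φ s) atTop (𝓝 0) := by
    have hlim : Tendsto (fun s : ℝ => Real.exp (-μ * s) * C) atTop (𝓝 0) := by
      simpa using (Real.tendsto_exp_atBot.comp
        (tendsto_id.const_mul_atTop_of_neg (neg_lt_zero.2 hμ))).mul_const C
    refine squeeze_zero_norm' ?_ hlim
    filter_upwards [eventually_gt_atTop 0] with s hs
    rw [norm_mul, norm_neg, Real.norm_of_nonneg (Real.exp_pos _).le]
    exact mul_le_mul_of_nonneg_left (abs_heatAverage_le hC hs) (Real.exp_pos _).le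
  have hparts := integral_Ioi_deriv_mul_eq_sub (u := fun s => -Real.exp (-μ * s))
    (fun s _ => hexp s) (fun s hs => hasDerivAt_heatAverage hφ hc hs)
    (hint.congr (.of_forall fun s => by
      simp only [neg_mul, Pi.sub_apply, Pi.add_apply, Pi.mul_apply]; ring)) hstart hdecay
  simpa only [mul_assoc, neg_mul, ← sub_eq_add_neg, zero_sub, neg_neg] using hparts

theorem integral_resolventKernel_mul_sub_laplacian (hμ : 0 < μ) {φ : E → ℝ}
    (hφ : ContDiff ℝ ∞ φ) (hc : HasCompactSupport φ) :
    ∫ y, resolventKernel μ y * (μ * φ y - Δ φ y) = φ 0 := by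
  have hG : Integrable (resolventKernel μ : E → ℝ) := integrable_resolventKernel hμ
  have hΔ := (contDiff_laplacian hφ).continuous
  obtain ⟨C, hC⟩ := hc.exists_bound_of_continuous hφ.continuous
  obtain ⟨C', hC'⟩ := (hasCompactSupport_laplacian hc).exists_bound_of_continuous hΔ
  simp only [mul_sub, mul_left_comm _ μ]
  rw [integral_sub ((hG.mul_bdd hφ.continuous.aestronglyMeasurable (.of_forall hC)).const_mul μ)
      (hG.mul_bdd hΔ.aestronglyMeasurable (.of_forall hC')), integral_const_mul,
    integral_resolventKernel_mul hμ hφ.continuous hC, integral_resolventKernel_mul hμ hΔ hC',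
    ← integral_const_mul, ← integral_sub
      ((integrableOn_exp_mul_heatAverage hμ hφ.continuous hC).const_mul μ)
      (integrableOn_exp_mul_heatAverage hμ hΔ hC'), integral_exp_mul_heatAverage_sub hμ hφ hc]

theorem integral_resolventKernel_sub_mul_sub_laplacian (hμ : 0 < μ) {φ : E → ℝ}
    (hφ : ContDiff ℝ ∞ φ) (hc : HasCompactSupport φ) (y : E) :
    ∫ x, resolventKernel μ (x - y) * (μ * φ x - Δ φ x) = φ y := by
  have hΔ (z : E) : Δ (fun z : E => φ (y + z)) z = Δ φ (y + z) := by
    simpa using laplacian_comp_const_add_smul hφ y 1 z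
  have htranslate := integral_resolventKernel_mul_sub_laplacian hμ (φ := fun z => φ (y + z))
    (hφ.comp (contDiff_const.add contDiff_id)) (hc.comp_homeomorph (Homeomorph.addLeft y))
  simp only [hΔ, add_zero] at htranslate
  rw [← htranslate, ← integral_add_left_eq_self _ y]
  simp only [add_sub_cancel_left]

theorem convolutionExistsAt_of_integrable_of_bounded {G f : E → ℝ} {C : ℝ} (hG : Integrable G)
    (hf : AEStronglyMeasurable f volume) (hC : ∀ x, |f x| ≤ C) (x : E) :
    ConvolutionExistsAt G f x (ContinuousLinearMap.lsmul ℝ ℝ) :=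
  hG.mul_bdd (hf.comp_quasiMeasurePreserving
    (quasiMeasurePreserving_sub_left_of_right_invariant volume x)) (.of_forall fun _ => hC _)

theorem locallyIntegrable_of_bounded {f : E → ℝ} {C : ℝ} (hf : AEStronglyMeasurable f volume)
    (hC : ∀ x, |f x| ≤ C) : LocallyIntegrable f volume :=
  (memLp_top_of_bound hf C (.of_forall hC)).locallyIntegrable le_top

theorem continuous_convolution_of_integrable {G f : E → ℝ} {C : ℝ} (hG : Integrable G)
    (hf : AEStronglyMeasurable f volume) (hC : ∀ x, |f x| ≤ C) : Continuous (G ⋆ f) := by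
  have hC0 : 0 ≤ C := (abs_nonneg _).trans (hC 0)
  have hconv {k : E → ℝ} (hk : Integrable k) (x : E) :=
    convolutionExistsAt_of_integrable_of_bounded hk hf hC x
  refine continuous_of_uniform_approx_of_continuous fun U hU => ?_
  obtain ⟨ε, hε, hεU⟩ := Metric.mem_uniformity_dist.1 hU
  obtain ⟨g, hgc, hgG, hg, hgi⟩ := hG.exists_hasCompactSupport_integral_sub_le
    (show 0 < ε / (C + 1) by positivity)
  refine ⟨g ⋆ f, hgc.continuous_convolution_left _ hg (locallyIntegrable_of_bounded hf hC),
    fun x => hεU ?_⟩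
  rw [Real.dist_eq, ← sub_convolution_apply (hconv hG x) (hconv hgi x)]
  calc |((G - g) ⋆ f) x| ≤ C * ∫ z, |(G - g) z| :=
        abs_convolution_le (hG.sub hgi) fun y _ => hC y
    _ ≤ C * (ε / (C + 1)) := mul_le_mul_of_nonneg_left hgG hC0
    _ < ε := by
      rw [mul_div_left_comm]
      exact mul_lt_of_lt_one_right hε ((div_lt_one (by positivity)).2 (lt_add_one C))

theorem integral_convolution_mul {G f ψ : E → ℝ} {C : ℝ} (hG : Integrable G)
    (hf : AEStronglyMeasurable f volume) (hC : ∀ x, |f x| ≤ C) (hψ : Integrable ψ) :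
    ∫ x, (G ⋆ f) x * ψ x = ∫ y, f y * ∫ x, G (x - y) * ψ x := by
  have hprod : Integrable (fun p : E × E => f p.1 * (G (p.2 - p.1) * ψ p.2))
      (volume.prod volume) := by
    have hker := hψ.convolution_integrand (ContinuousLinearMap.lsmul ℝ ℝ) hG.comp_neg
      (μ := volume) (ν := volume)
    refine (hker.bdd_mul (f := fun p : E × E => f p.1) (c := C) hf.comp_fst
      (.of_forall fun p => hC p.1)).congr (.of_forall fun p => ?_)
    simp [mul_comm]
  calc ∫ x, (G ⋆ f) x * ψ x = ∫ x, ∫ y, f y * (G (x - y) * ψ x) := by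
        simp only [convolution_lsmul_swap, smul_eq_mul, ← integral_mul_const, mul_assoc,
          mul_left_comm (G _)]
    _ = ∫ y, ∫ x, f y * (G (x - y) * ψ x) := (integral_integral_swap hprod).symm
    _ = ∫ y, f y * ∫ x, G (x - y) * ψ x := by simp only [integral_const_mul]

theorem hasWeakLaplacian_convolution_resolventKernel (hμ : 0 < μ) {f : E → ℝ} {C : ℝ}
    (hf : AEStronglyMeasurable f volume) (hC : ∀ x, |f x| ≤ C) :
    HasWeakLaplacian (resolventKernel μ ⋆ f) (fun x => μ * (resolventKernel μ ⋆ f) x - f x) := by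
  set S := resolventKernel μ ⋆ f
  have hG : Integrable (resolventKernel μ : E → ℝ) := integrable_resolventKernel hμ
  have hS : Continuous S := continuous_convolution_of_integrable hG hf hC
  have hli := locallyIntegrable_of_bounded hf hC
  have hμS : Continuous fun x => μ * S x := continuous_const.mul hS
  refine ⟨hS.locallyIntegrable, hμS.locallyIntegrable.sub hli, fun φ hφ hc => ?_⟩
  have hμφ : Continuous fun x => μ * φ x := continuous_const.mul hφ.continuous
  have hΔ := (contDiff_laplacian hφ).continuous
  have hΔc := hasCompactSupport_laplacian hc
  have hdual : ∫ x, S x * (μ * φ x - Δ φ x) = ∫ y, f y * φ y := by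
    refine (integral_convolution_mul hG hf hC ((hμφ.integrable_of_hasCompactSupport
      hc.mul_left).sub (hΔ.integrable_of_hasCompactSupport hΔc))).trans ?_
    simp only [Pi.sub_apply, integral_resolventKernel_sub_mul_sub_laplacian hμ hφ hc]
  have hsplit : ∫ x, S x * (μ * φ x - Δ φ x) = (∫ x, μ * S x * φ x) - ∫ x, S x * Δ φ x := by
    rw [← integral_sub (integrable_mul_of_locallyIntegrable hμS.locallyIntegrable hφ.continuous hc)
      (integrable_mul_of_locallyIntegrable hS.locallyIntegrable hΔ hΔc)]
    exact integral_congr_ae (.of_forall fun x => by ring)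
  simp only [sub_mul]
  rw [integral_sub (integrable_mul_of_locallyIntegrable hμS.locallyIntegrable hφ.continuous hc)
    (integrable_mul_of_locallyIntegrable hli hφ.continuous hc), ← hdual, hsplit, sub_sub_cancel]

end Resolvent

section SemilinearResolvent

open scoped BoundedContinuousFunction NNReal

variable {X : Type*}

/-- The forcing `L s - H x s`, with `H x` frozen outside `[-c, c]`: solving
`Δ y = ε y + H x y` amounts to solving `(L + ε - Δ) y = L y - H x y`. -/
noncomputable def truncatedForcing (H : X → ℝ → ℝ) {c : ℝ} (hc : 0 ≤ c) (L : ℝ≥0) (x : X)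
    (s : ℝ) : ℝ :=
  L * s - H x (Set.projIcc (-c) c (neg_le_self hc) s)

theorem truncatedForcing_of_abs_le (H : X → ℝ → ℝ) {c : ℝ} (hc : 0 ≤ c) (L : ℝ≥0) (x : X) {s : ℝ}
    (hs : |s| ≤ c) : truncatedForcing H hc L x s = L * s - H x s := by
  rw [truncatedForcing, Set.projIcc_of_mem _ (abs_le.1 hs)]

theorem lipschitzOnWith_indicator {H : X → ℝ → ℝ} {L : ℝ≥0} {s : Set X} {S : Set ℝ} {x : X}
    (h : x ∈ s → LipschitzOnWith L (H x) S) : LipschitzOnWith L (s.indicator H x) S := by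
  by_cases hx : x ∈ s
  · simpa only [Set.indicator_of_mem hx] using h hx
  · rw [Set.indicator_of_notMem hx]
    exact ((LipschitzWith.const (0 : ℝ)).weaken zero_le).lipschitzOnWith

section Barriers

variable [TopologicalSpace X] [MeasurableSpace X]

/-- A nonlinearity `H x s`, nondecreasing in `s ∈ [-c, c]`, for which the constants `-c` and `c`
are a sub- and a supersolution of `Δ y = H x (y x)`. Measurability is required along continuous
functions only, so that `H` may be discontinuous in `x`. -/
structure IsMonotoneBetweenBarriers (H : X → ℝ → ℝ) (c : ℝ) (ν : Measure X) : Prop where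
  aestronglyMeasurable : ∀ f : X → ℝ, Continuous f → AEStronglyMeasurable (fun x => H x (f x)) ν
  monotoneOn : ∀ x, MonotoneOn (H x) (Set.Icc (-c) c)
  apply_neg_nonpos : ∀ x, H x (-c) ≤ 0
  apply_nonneg : ∀ x, 0 ≤ H x c

theorem IsMonotoneBetweenBarriers.indicator {H : X → ℝ → ℝ} {c : ℝ} {ν : Measure X}
    (h : IsMonotoneBetweenBarriers H c ν) {s : Set X} (hs : MeasurableSet s) :
    IsMonotoneBetweenBarriers (s.indicator H) c ν where
  aestronglyMeasurable f hf := by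
    refine ((h.aestronglyMeasurable f hf).indicator hs).congr (.of_forall fun x => ?_)
    by_cases hx : x ∈ s <;> simp [hx]
  monotoneOn x := by
    by_cases hx : x ∈ s
    · simpa only [Set.indicator_of_mem hx] using h.monotoneOn x
    · rw [Set.indicator_of_notMem hx]
      exact monotoneOn_const
  apply_neg_nonpos x := by
    by_cases hx : x ∈ s <;> simp [hx, h.apply_neg_nonpos x]
  apply_nonneg x := by
    by_cases hx : x ∈ s <;> simp [hx, h.apply_nonneg x]

theorem IsMonotoneBetweenBarriers.abs_le {H : X → ℝ → ℝ} {c : ℝ} {ν : Measure X}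
    (h : IsMonotoneBetweenBarriers H c ν) {x : X} {L : ℝ≥0}
    (hL : LipschitzOnWith L (H x) (Set.Icc (-c) c)) {s : ℝ} (hs : |s| ≤ c) :
    |H x s| ≤ L * (2 * c) := by
  have hc : -c ≤ c := neg_le_self ((abs_nonneg s).trans hs)
  have hleft : -c ∈ Set.Icc (-c) c := Set.left_mem_Icc.2 hc
  have hright : c ∈ Set.Icc (-c) c := Set.right_mem_Icc.2 hc
  have hlow := h.monotoneOn x hleft (Set.mem_Icc.2 (_root_.abs_le.1 hs)) (_root_.abs_le.1 hs).1
  have hupp := h.monotoneOn x (Set.mem_Icc.2 (_root_.abs_le.1 hs)) hright (_root_.abs_le.1 hs).2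
  have hosc : H x c - H x (-c) ≤ L * (2 * c) := by
    have hdist := hL.dist_le_mul c hright (-c) hleft
    rw [Real.dist_eq, Real.dist_eq, sub_neg_eq_add, ← two_mul,
      abs_of_nonneg (by linarith : 0 ≤ 2 * c)] at hdist
    exact (le_abs_self _).trans hdist
  rw [_root_.abs_le]
  constructor <;> linarith [h.apply_neg_nonpos x, h.apply_nonneg x]

variable {H : X → ℝ → ℝ} {c : ℝ} {ν : Measure X} {L : ℝ≥0} {x : X}

theorem truncatedForcing_sub_mem_Icc (h : IsMonotoneBetweenBarriers H c ν) (hc : 0 ≤ c)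
    (hL : LipschitzOnWith L (H x) (Set.Icc (-c) c)) {s s' : ℝ} (hs : s ≤ s') :
    truncatedForcing H hc L x s' - truncatedForcing H hc L x s ∈ Set.Icc 0 (L * (s' - s)) := by
  set p := Set.projIcc (-c) c (neg_le_self hc)
  have hmono : H x (p s) ≤ H x (p s') :=
    h.monotoneOn x (p s).2 (p s').2 (Set.monotone_projIcc _ hs)
  have hlip : H x (p s') - H x (p s) ≤ L * (s' - s) :=
    calc H x (p s') - H x (p s) ≤ dist (H x (p s')) (H x (p s)) := le_abs_self _
      _ ≤ L * dist (p s') (p s) := hL.dist_le_mul _ (p s').2 _ (p s).2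
      _ ≤ L * (s' - s) := by
        have hp := (LipschitzWith.projIcc (neg_le_self hc)).dist_le_mul s' s
        rw [NNReal.coe_one, one_mul, Real.dist_eq, abs_of_nonneg (sub_nonneg.2 hs)] at hp
        exact mul_le_mul_of_nonneg_left hp L.2
  simp only [truncatedForcing, Set.mem_Icc]
  constructor <;> linarith

theorem lipschitzWith_truncatedForcing (h : IsMonotoneBetweenBarriers H c ν) (hc : 0 ≤ c)
    (hL : LipschitzOnWith L (H x) (Set.Icc (-c) c)) :
    LipschitzWith L (truncatedForcing H hc L x) := by
  refine LipschitzWith.of_dist_le_mul fun s s' => ?_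
  wlog hs : s' ≤ s generalizing s s'
  · simpa only [dist_comm] using this s' s (le_of_not_ge hs)
  have hincr := truncatedForcing_sub_mem_Icc h hc hL hs
  rw [Real.dist_eq, Real.dist_eq, abs_of_nonneg hincr.1, abs_of_nonneg (sub_nonneg.2 hs)]
  exact hincr.2

theorem abs_truncatedForcing_le (h : IsMonotoneBetweenBarriers H c ν) (hc : 0 ≤ c)
    (hL : LipschitzOnWith L (H x) (Set.Icc (-c) c)) (s : ℝ) :
    |truncatedForcing H hc L x s| ≤ L * max |s| c := by
  set m := max |s| c
  have hcm : c ≤ m := le_max_right _ _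
  obtain ⟨hsl, hsu⟩ := abs_le.1 (le_max_left |s| c)
  have hlow : -(L * m) ≤ truncatedForcing H hc L x (-m) := by
    rw [truncatedForcing, Set.projIcc_of_le_left _ (neg_le_neg hcm)]
    linarith [h.apply_neg_nonpos x]
  have hupp : truncatedForcing H hc L x m ≤ L * m := by
    rw [truncatedForcing, Set.projIcc_of_right_le _ hcm]
    linarith [h.apply_nonneg x]
  rw [abs_le]
  constructor <;> linarith [(truncatedForcing_sub_mem_Icc h hc hL hsl).1,
    (truncatedForcing_sub_mem_Icc h hc hL hsu).1]

end Barriers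

variable {E : Type*} [NormedAddCommGroup E] [InnerProductSpace ℝ E] [FiniteDimensional ℝ E]
  [MeasurableSpace E] [BorelSpace E] {μ : ℝ}

theorem abs_convolution_resolventKernel_le (hμ : 0 < μ) {f : E → ℝ} {C : ℝ}
    (hC : ∀ x, |f x| ≤ C) (x : E) : |(resolventKernel μ ⋆ f) x| ≤ C / μ := by
  simpa only [integral_abs_resolventKernel hμ, div_eq_mul_inv] using
    abs_convolution_le (x := x) (integrable_resolventKernel hμ) fun y _ => hC y

theorem exists_eq_convolution_resolventKernel {N : E → ℝ → ℝ} {L : ℝ≥0} (hLμ : L < μ) {B : ℝ}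
    (hmeas : ∀ f : E → ℝ, Continuous f → AEStronglyMeasurable (fun x => N x (f x)) volume)
    (hlip : ∀ x, LipschitzWith L (N x)) (hB : ∀ x, |N x 0| ≤ B) :
    ∃ y : E →ᵇ ℝ, ⇑y = resolventKernel μ ⋆ fun x => N x (y x) := by
  have hμ : 0 < μ := L.2.trans_lt hLμ
  have hG : Integrable (resolventKernel μ : E → ℝ) := integrable_resolventKernel hμ
  have hN (f g : E →ᵇ ℝ) (x : E) : |N x (f x) - N x (g x)| ≤ L * dist f g :=
    ((hlip x).dist_le_mul (f x) (g x)).trans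
      (mul_le_mul_of_nonneg_left (f.dist_coe_le_dist x) L.2)
  have hbdd (f : E →ᵇ ℝ) (x : E) : |N x (f x)| ≤ L * dist f 0 + B := by
    have := (abs_add_le (N x (f x) - N x 0) (N x 0)).trans (add_le_add (hN f 0 x) (hB x))
    rwa [sub_add_cancel] at this
  have hexists (f : E →ᵇ ℝ) (x : E) :=
    convolutionExistsAt_of_integrable_of_bounded hG (hmeas f f.continuous) (hbdd f) x
  let T (f : E →ᵇ ℝ) : E →ᵇ ℝ :=
    .ofNormedAddCommGroup (resolventKernel μ ⋆ fun x => N x (f x))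
      (continuous_convolution_of_integrable hG (hmeas f f.continuous) (hbdd f)) _
      (abs_convolution_resolventKernel_le hμ (hbdd f))
  have hT : ContractingWith (Real.toNNReal (L / μ)) T := by
    refine ⟨Real.toNNReal_lt_one.2 ((div_lt_one hμ).2 hLμ), .of_dist_le_mul fun f g => ?_⟩
    rw [Real.coe_toNNReal _ (div_nonneg L.coe_nonneg hμ.le), div_mul_eq_mul_div]
    refine (BoundedContinuousFunction.dist_le
      (div_nonneg (mul_nonneg L.2 dist_nonneg) hμ.le)).2 fun x => ?_
    have hdiff := convolution_sub_apply (hexists f x) (hexists g x)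
    rw [Real.dist_eq]
    exact hdiff ▸ abs_convolution_resolventKernel_le hμ (hN f g) x
  exact ⟨hT.fixedPoint, congrArg DFunLike.coe hT.fixedPoint_isFixedPt.symm⟩

theorem abs_le_of_eq_convolution_resolventKernel {N : E → ℝ → ℝ} {L : ℝ≥0} (hLμ : L < μ) {c : ℝ}
    (hc : 0 ≤ c) (hN : ∀ x s, |N x s| ≤ L * max |s| c) {y : E →ᵇ ℝ}
    (hy : ⇑y = resolventKernel μ ⋆ fun x => N x (y x)) (x : E) : |y x| ≤ c := by
  have hμ : 0 < μ := L.2.trans_lt hLμ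
  have hnorm : ‖y‖ ≤ L * max ‖y‖ c / μ := by
    refine (BoundedContinuousFunction.norm_le (by positivity)).2 fun z => ?_
    rw [hy]
    refine abs_convolution_resolventKernel_le hμ (fun z => (hN z (y z)).trans ?_) z
    exact mul_le_mul_of_nonneg_left (max_le_max (y.norm_coe_le_norm z) le_rfl) L.2
  refine (y.norm_coe_le_norm x).trans (le_of_not_gt fun hlt => ?_)
  rw [max_eq_left hlt.le, le_div_iff₀ hμ, mul_comm] at hnorm
  exact hLμ.not_ge (le_of_mul_le_mul_right hnorm (hc.trans_lt hlt))

theorem exists_hasWeakLaplacian_of_lipschitzOnWith {H : E → ℝ → ℝ} {c : ℝ} (hc : 0 ≤ c)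
    (h : IsMonotoneBetweenBarriers H c volume) {L : ℝ≥0}
    (hL : ∀ x, LipschitzOnWith L (H x) (Set.Icc (-c) c)) {ε : ℝ} (hε : 0 < ε) :
    ∃ y : E → ℝ, Continuous y ∧ (∀ x, |y x| ≤ c) ∧
      HasWeakLaplacian y (fun x => ε * y x + H x (y x)) := by
  set N := truncatedForcing H hc L
  have hLμ : (L : ℝ) < L + ε := lt_add_of_pos_right _ hε
  have hmeas (f : E → ℝ) (hf : Continuous f) :
      AEStronglyMeasurable (fun x => N x (f x)) volume :=
    (hf.aestronglyMeasurable.const_mul _).sub (h.aestronglyMeasurable _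
      (continuous_subtype_val.comp (continuous_projIcc.comp hf)))
  have hN (x : E) (s : ℝ) : |N x s| ≤ L * max |s| c := abs_truncatedForcing_le h hc (hL x) s
  obtain ⟨y, hy⟩ := exists_eq_convolution_resolventKernel hLμ hmeas
    (fun x => lipschitzWith_truncatedForcing h hc (hL x)) (fun x => hN x 0)
  have hyc := abs_le_of_eq_convolution_resolventKernel hLμ hc hN hy
  have hNy (x : E) : |N x (y x)| ≤ L * c := by
    simpa only [max_eq_right (hyc x)] using hN x (y x)
  refine ⟨y, y.continuous, hyc, ?_⟩
  have hweak := hasWeakLaplacian_convolution_resolventKernel (L.2.trans_lt hLμ)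
    (hmeas y y.continuous) hNy
  rw [← hy] at hweak
  refine hweak.congr_ae .rfl (.of_forall fun x => ?_)
  simp only [N, truncatedForcing_of_abs_le H hc L x (hyc x)]
  ring

end SemilinearResolvent

section Existence

open scoped NNReal

section Regularization

variable {E : Type*} [NormedAddCommGroup E] {H : E → ℝ → ℝ} {c : ℝ} {L : ℝ≥0} {x : E} {s : ℝ}

/-- The approximation of `H x s` by `s / (n + 1) + H x s 1_{|x| ≤ n}`, which is globally Lipschitz
in `s` when `H` is so locally in `x`, and to which the resolvent applies. -/
noncomputable def regularization (H : E → ℝ → ℝ) (n : ℕ) (x : E) (s : ℝ) : ℝ :=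
  1 / ((n : ℝ) + 1) * s + (Metric.closedBall 0 (n : ℝ)).indicator H x s

theorem tendsto_regularization (hH : ContinuousOn (H x) (Set.Icc (-c) c)) {σ : ℕ → ℝ}
    (hσ : Tendsto σ atTop (𝓝 s)) (hσc : ∀ n, |σ n| ≤ c) {θ : ℕ → ℕ} (hθ : Tendsto θ atTop atTop) :
    Tendsto (fun n => regularization H (θ n) x (σ n)) atTop (𝓝 (H x s)) := by
  have hsc : |s| ≤ c := le_of_tendsto hσ.abs (.of_forall hσc)
  have hε : Tendsto (fun n => 1 / ((θ n : ℝ) + 1) * σ n) atTop (𝓝 0) := by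
    simpa only [zero_mul, Function.comp_apply] using
      (tendsto_one_div_add_atTop_nhds_zero_nat.comp hθ).mul hσ
  have hlim : Tendsto (fun n => H x (σ n)) atTop (𝓝 (H x s)) :=
    (hH s (abs_le.1 hsc)).tendsto.comp
      (tendsto_nhdsWithin_iff.2 ⟨hσ, .of_forall fun n => abs_le.1 (hσc n)⟩)
  have hball : ∀ᶠ n in atTop, (Metric.closedBall 0 (θ n : ℝ)).indicator H x = H x := by
    filter_upwards [hθ.eventually (eventually_ge_atTop ⌈‖x‖⌉₊)] with n hn
    exact Set.indicator_of_mem (mem_closedBall_zero_iff.2 (Nat.ceil_le.1 hn)) _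
  simpa only [zero_add, regularization] using
    hε.add (hlim.congr' (hball.mono fun n hn => by rw [hn]))

theorem exists_hasWeakLaplacian_regularization [InnerProductSpace ℝ E] [FiniteDimensional ℝ E]
    [MeasurableSpace E] [BorelSpace E] (hc : 0 ≤ c)
    (h : IsMonotoneBetweenBarriers H c volume) {n : ℕ}
    (hL : ∀ x, ‖x‖ ≤ n → LipschitzOnWith L (H x) (Set.Icc (-c) c)) :
    ∃ y : E → ℝ, Continuous y ∧ (∀ x, |y x| ≤ c) ∧
      HasWeakLaplacian y (fun x => regularization H n x (y x)) :=
  exists_hasWeakLaplacian_of_lipschitzOnWith hc (h.indicator measurableSet_closedBall)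
    (fun x => lipschitzOnWith_indicator fun hx => hL x (mem_closedBall_zero_iff.1 hx))
    Nat.one_div_pos_of_nat

variable [MeasurableSpace E] [OpensMeasurableSpace E]

theorem abs_regularization_le {ν : Measure E} (h : IsMonotoneBetweenBarriers H c ν)
    (hL : LipschitzOnWith L (H x) (Set.Icc (-c) c)) (hs : |s| ≤ c) (n : ℕ) :
    |regularization H n x s| ≤ c + L * (2 * c) := by
  have hn : |1 / ((n : ℝ) + 1)| ≤ 1 := by
    rw [abs_of_pos Nat.one_div_pos_of_nat]
    exact div_le_one_of_le₀ (by simp) (by positivity)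
  refine (abs_add_le _ _).trans (add_le_add ?_ ?_)
  · rw [abs_mul]
    exact (mul_le_of_le_one_left (abs_nonneg s) hn).trans hs
  · exact (h.indicator measurableSet_closedBall).abs_le (lipschitzOnWith_indicator fun _ => hL) hs

end Regularization

theorem exists_hasWeakLaplacian_of_barriers {w : Plane → ℝ} (hw : ContDiff ℝ ∞ w)
    (hlog : ∀ x, 1 ≤ ‖x‖ → w x = Real.log ‖x‖) {H : Plane → ℝ → ℝ} {c : ℝ} (hc : 0 ≤ c)
    (h : IsMonotoneBetweenBarriers H c volume)
    (hL : ∀ R : ℝ, ∃ L : ℝ≥0, ∀ x, ‖x‖ ≤ R → LipschitzOnWith L (H x) (Set.Icc (-c) c)) :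
    ∃ y : Plane → ℝ, Continuous y ∧ (∀ x, |y x| ≤ c) ∧
      HasWeakLaplacian y (fun x => H x (y x)) := by
  choose Y hYcont hYc hY using fun n : ℕ =>
    (hL n).elim fun _ hL => exists_hasWeakLaplacian_regularization hc h hL
  have hbound (R : ℝ) : ∃ M, ∀ n x, ‖x‖ ≤ R → |regularization H n x (Y n x)| ≤ M :=
    (hL R).imp' _ fun _ hL n x hx => abs_regularization_le h (hL x hx) (hYc n x) n
  obtain ⟨y, θ, hθ, hy, hlim⟩ := exists_tendsto_subseq_of_equicontinuous
    (equicontinuous_of_hasWeakLaplacian hw hlog hY hYcont hYc hbound) hYc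
  have hyc (x : Plane) : |y x| ≤ c :=
    le_of_tendsto (hlim x).abs (.of_forall fun n => hYc (θ n) x)
  have hHy : IsLocallyBounded fun x => H x (y x) := fun R =>
    (hL R).imp' _ fun _ hL x hx => h.abs_le (hL x hx) (hyc x)
  refine ⟨y, hy, hyc, HasWeakLaplacian.of_tendsto (fun n => hY (θ n)) (fun n => hYc (θ n))
    (fun R => (hbound R).imp fun M hM n => hM (θ n)) hy.locallyIntegrable
    (hHy.locallyIntegrable (h.aestronglyMeasurable y hy)) hlim fun x => ?_⟩
  obtain ⟨L, hL⟩ := hL ‖x‖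
  exact tendsto_regularization (hL x le_rfl).continuousOn (hlim x) (fun n => hYc (θ n) x)
    hθ.tendsto_atTop

theorem exp_sub_exp_le_sub_mul_exp (a b : ℝ) :
    Real.exp b - Real.exp a ≤ (b - a) * Real.exp b := by
  have h := mul_le_mul_of_nonneg_right (Real.add_one_le_exp (a - b)) (Real.exp_pos b).le
  rw [← Real.exp_add, sub_add_cancel] at h
  linarith

theorem lipschitzOnWith_mul_exp_sub {q a Q V c : ℝ} (hq : 0 ≤ q) (hqQ : q ≤ Q) (ha : |a| ≤ V)
    (k : ℝ) : LipschitzOnWith (Q * (2 * Real.exp (2 * (c + V)))).toNNReal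
      (fun s => q * (Real.exp (2 * (s + a)) - k)) (Set.Icc (-c) c) := by
  have hQ : 0 ≤ Q := hq.trans hqQ
  refine LipschitzOnWith.of_dist_le_mul fun s hs s' hs' => ?_
  wlog hle : s' ≤ s generalizing s s'
  · simpa only [dist_comm] using this s' hs' s hs (le_of_not_ge hle)
  have hexp : Real.exp (2 * (s + a)) ≤ Real.exp (2 * (c + V)) :=
    Real.exp_le_exp.2 (by linarith [hs.2, (abs_le.1 ha).2])
  have hmono : Real.exp (2 * (s' + a)) ≤ Real.exp (2 * (s + a)) :=
    Real.exp_le_exp.2 (by linarith)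
  rw [Real.dist_eq, Real.dist_eq, ← mul_sub, sub_sub_sub_cancel_right, abs_mul, abs_of_nonneg hq,
    abs_of_nonneg (sub_nonneg.2 hmono), abs_of_nonneg (sub_nonneg.2 hle),
    Real.coe_toNNReal _ (by positivity), mul_assoc]
  refine mul_le_mul hqQ ?_ (sub_nonneg.2 hmono) hQ
  calc Real.exp (2 * (s + a)) - Real.exp (2 * (s' + a))
      ≤ (2 * (s + a) - 2 * (s' + a)) * Real.exp (2 * (s + a)) := exp_sub_exp_le_sub_mul_exp _ _
    _ = 2 * Real.exp (2 * (s + a)) * (s - s') := by ring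
    _ ≤ 2 * Real.exp (2 * (c + V)) * (s - s') :=
        mul_le_mul_of_nonneg_right (mul_le_mul_of_nonneg_left hexp two_pos.le) (sub_nonneg.2 hle)

theorem isMonotoneBetweenBarriers_mul_exp_sub_exp {X : Type*} [TopologicalSpace X]
    [MeasurableSpace X] [OpensMeasurableSpace X] {ν : Measure X} {q a : X → ℝ} {V : ℝ}
    (hqm : AEStronglyMeasurable q ν) (hq : ∀ x, 0 ≤ q x) (ha : Continuous a) (haV : ∀ x, |a x| ≤ V)
    (t : ℝ) :
    IsMonotoneBetweenBarriers
      (fun x s => q x * (Real.exp (2 * (s + a x)) - Real.exp (2 * t))) (V + |t|) ν where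
  aestronglyMeasurable f hf := hqm.mul (by fun_prop : Continuous fun x =>
    Real.exp (2 * (f x + a x)) - Real.exp (2 * t)).aestronglyMeasurable
  monotoneOn x s _ s' _ hs := mul_le_mul_of_nonneg_left
    (sub_le_sub_right (Real.exp_le_exp.2 (by linarith)) _) (hq x)
  apply_neg_nonpos x := mul_nonpos_of_nonneg_of_nonpos (hq x) (sub_nonpos.2
    (Real.exp_le_exp.2 (by linarith [(abs_le.1 (haV x)).2, neg_abs_le t])))
  apply_nonneg x := mul_nonneg (hq x) (sub_nonneg.2
    (Real.exp_le_exp.2 (by linarith [(abs_le.1 (haV x)).1, le_abs_self t])))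

section LogGrowth

variable {w K : Plane → ℝ} {α t : ℝ} (hw : ContDiff ℝ ∞ w)
  (hlog : ∀ x, 1 ≤ ‖x‖ → w x = Real.log ‖x‖) (hKb : IsLocallyBounded K)

include hw hlog hKb

theorem exists_continuous_bounded_solution {v : Plane → ℝ} {C : ℝ} (hC : ∀ x, |v x| ≤ C)
    (hv : SolvesPoisson v (fun x => K x * Real.exp (2 * α * w x + 2 * t) + α * Δ w x)) :
    ∃ a : Plane → ℝ, Continuous a ∧ (∀ x, |a x| ≤ C) ∧ HasWeakLaplacian
      (fun x => α * w x + a x) (fun x => -K x * Real.exp (2 * α * w x + 2 * t)) := by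
  have hweak : HasWeakLaplacian (fun x => α * w x + v x)
      (fun x => -K x * Real.exp (2 * α * w x + 2 * t)) :=
    (((hasWeakLaplacian_of_contDiff hw).const_mul α).add
      (solvesPoisson_iff_hasWeakLaplacian_neg.1 hv)).congr_ae .rfl (.of_forall fun x => by ring)
  have hwcont := hw.continuous
  have hexp : Continuous fun x => Real.exp (2 * α * w x + 2 * t) := by fun_prop
  obtain ⟨z, hz, hvz, -⟩ := exists_continuous_representative hw hlog hweak
    (hKb.neg.mul (.of_continuous hexp))
  have ha : Continuous fun x => z x - α * w x := by fun_prop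
  refine ⟨fun x => z x - α * w x, ha, fun x => ?_, by
    simpa only [add_sub_cancel] using hweak.congr_ae hvz .rfl⟩
  have hae : ∀ᵐ y, |z y - α * w y| ≤ C := by
    filter_upwards [hvz] with y hy
    simpa only [← hy, add_sub_cancel_left] using hC y
  have hclosed : IsClosed {y | |z y - α * w y| ≤ C} := isClosed_le ha.abs continuous_const
  exact hclosed.closure_subset (Measure.dense_of_ae hae x)

theorem exists_isLogGrowthSolution (hKm : AEStronglyMeasurable K volume) (hK : ∀ x, K x ≤ 0)
    {v : Plane → ℝ} {C : ℝ} (hC : ∀ x, |v x| ≤ C)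
    (hv : SolvesPoisson v (fun x => K x * Real.exp (2 * α * w x + 2 * t) + α * Δ w x)) :
    ∃ u, IsLogGrowthSolution K α u := by
  obtain ⟨a, ha, haC, haweak⟩ := exists_continuous_bounded_solution hw hlog hKb hC hv
  have hwcont := hw.continuous
  have hexp : Continuous fun x => Real.exp (2 * α * w x) := by fun_prop
  let q (x : Plane) : ℝ := -K x * Real.exp (2 * α * w x)
  have hq (x : Plane) : 0 ≤ q x := mul_nonneg (neg_nonneg.2 (hK x)) (Real.exp_pos _).le
  have hqb : IsLocallyBounded q := hKb.neg.mul (.of_continuous hexp)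
  obtain ⟨y, hy, hyc, hyweak⟩ := exists_hasWeakLaplacian_of_barriers hw hlog
    (add_nonneg ((abs_nonneg _).trans (haC 0)) (abs_nonneg t))
    (isMonotoneBetweenBarriers_mul_exp_sub_exp (hKm.neg.mul hexp.aestronglyMeasurable) hq ha haC t)
    fun R => (hqb R).imp' _ fun Q hQ x hx =>
      lipschitzOnWith_mul_exp_sub (hq x) ((le_abs_self _).trans (hQ x hx)) (haC x) _
  refine ⟨fun x => α * w x + a x + y x, by fun_prop,
    solvesPoisson_iff_hasWeakLaplacian_neg.2 ((haweak.add hyweak).congr_ae .rfl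
      (.of_forall fun x => ?_)), isBigO_cocompact_one_iff.2
    ⟨1, C + (C + |t|), fun x hx => ?_⟩⟩
  · have hexpt : Real.exp (2 * α * w x + 2 * t) =
        Real.exp (2 * α * w x) * Real.exp (2 * t) := Real.exp_add _ _
    have hexpu : Real.exp (2 * (α * w x + a x + y x)) =
        Real.exp (2 * α * w x) * Real.exp (2 * (y x + a x)) := by
      rw [← Real.exp_add]
      ring_nf
    simp only [hexpt, hexpu, Pi.mul_apply, Pi.neg_apply]
    ring
  · simp only [← hlog x hx.le, add_assoc, add_sub_cancel_left]
    exact (abs_add_le _ _).trans (add_le_add (haC x) (hyc x))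

end LogGrowth

end Existence

theorem proposition3p2_general
    (w₀ : Plane → ℝ) (hw₀_smooth : ContDiff ℝ ∞ w₀)
    (hw₀_log : ∀ x : Plane, 1 ≤ ‖x‖ → w₀ x = Real.log ‖x‖)
    (K : Plane → ℝ) (hK_meas : AEStronglyMeasurable K volume)
    (hK_bdd : IsLocallyBounded K) (hK_nonpos : ∀ x, K x ≤ 0)
    (α : ℝ) (hα : 0 < α) (t : ℝ)
    (hv : ∃ v : Plane → ℝ, (∃ C : ℝ, ∀ x, |v x| ≤ C) ∧
      SolvesPoisson v (fun x => K x * Real.exp (2 * α * w₀ x + 2 * t) + α * Δ w₀ x)) :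
    (∃! u : Plane → ℝ, IsLogGrowthSolution K α u) ∧
    ∀ u : Plane → ℝ, IsLogGrowthSolution K α u →
      Integrable (fun x => K x * Real.exp (2 * u x)) volume ∧
        ∫ x, K x * Real.exp (2 * u x) = -2 * α * Real.pi := by
  obtain ⟨v, ⟨C, hC⟩, hv⟩ := hv
  obtain ⟨u, hu⟩ := exists_isLogGrowthSolution hw₀_smooth hw₀_log hK_bdd hK_meas hK_nonpos hC hv
  exact ⟨⟨u, hu, fun _ hu' => hu'.unique hu hK_nonpos hK_bdd hα.ne'⟩,
    fun _ hu' => hu'.integrable_and_integral_eq hK_nonpos⟩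

theorem proposition3p2
    (w₀ : Plane → ℝ) (hw₀_smooth : ContDiff ℝ ∞ w₀)
    (hw₀_radial : ∀ x y : Plane, ‖x‖ = ‖y‖ → w₀ x = w₀ y)
    (hw₀_log : ∀ x : Plane, 1 ≤ ‖x‖ → w₀ x = Real.log ‖x‖)
    (K : Plane → ℝ) (hK_meas : AEStronglyMeasurable K volume)
    (hK_bdd : IsLocallyBounded K) (hK_nonpos : ∀ x, K x ≤ 0)
    (α : ℝ) (hα : 0 < α) (t : ℝ)
    (hv : ∃ v : Plane → ℝ, (∃ C : ℝ, ∀ x, |v x| ≤ C) ∧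
      SolvesPoisson v (fun x => K x * Real.exp (2 * α * w₀ x + 2 * t)
        + α * (Laplacian.laplacian w₀ : Plane → ℝ) x)) :
    (∃! u : Plane → ℝ, IsLogGrowthSolution K α u) ∧
    ∀ u : Plane → ℝ, IsLogGrowthSolution K α u →
      Integrable (fun x => K x * Real.exp (2 * u x)) volume ∧
        ∫ x, K x * Real.exp (2 * u x) = -2 * α * Real.pi :=
  proposition3p2_general w₀ hw₀_smooth hw₀_log K hK_meas hK_bdd hK_nonpos α hα t hv
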